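/- Let $\alpha>0$ and $0\le\beta<1$. Let $E(\alpha)$ be the set of all $x\in\mathbb R$ such that $|x-r/q|\le |q|^{-(2+\alpha)}$ for infinitely many pairs $(q,r)\in\mathbb Z\times\mathbb Z$ with $q\neq0$. For a Borel probability measure $\mu$ on $\mathbb R$ and $f\in L^1(\mu)$ write $\mathcal F(\mu)(\xi)=\int e^{-2\pi i x\xi}\,d\mu(x)$ and $\mathcal F(f\mu)(\xi)=\int e^{-2\pi i x\xi}f(x)\,d\mu(x)$ for $\xi\in\mathbb R$, and let $\lambda=|\cdot|$ be Lebesgue measure on $\mathbb R$. There exists a Borel probability measure $\mu$ on $\mathbb R$ such that the following hold. 1. The (closed) support of $\mu$ is contained in $[-1/2,1/2]\cap E(\alpha)$. 2. For every $0<\epsilon<\frac{2}{2+\alpha}$ there is a constant $C>0$ such that $\mu(I)\le C\,|I|^{\frac{2}{2+\alpha}-\epsilon}$ for every interval $I\subseteq\mathbb R$. 3. For every $\epsilon>0$ there is a constant $C>0$ such that $|\mathcal F(\mu)(\xi)|\le C\,(1+|\xi|)^{-\frac{1-\beta}{2+\alpha}+\epsilon}$ for every $\xi\in\mathbb R$.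 4. There is a sequence of nonnegative functions $(f_k)_{k\in\mathbb N}$ on $\mathbb R$ such that for every $1\le q\le\infty$ one has $f_k\in L^q(\mu)$ and $\|f_k\|_{L^q(\mu)}\neq0$ for all $k$, and $$\sup_{k}\frac{\|\mathcal F(f_k\mu)\|_{L^p(\lambda)}}{\|f_k\|_{L^q(\mu)}}=\infty\qquad\text{whenever } 0<p<p_+(q):=\frac{q}{q-1}\cdot\frac{1+\alpha-\beta}{1-\beta},$$ where $\frac{q}{q-1}$ is read as $\infty$ if $q=1$ and as $1$ if $q=\infty$, and $\|\mathcal F(f_k\mu)\|_{L^p(\lambda)}=\infty$ if $\mathcal F(f_k\mu)\notin L^p(\lambda)$. -/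

import Mathlib

open MeasureTheory Set
open scoped ENNReal

/-- The set `E(α)` of `α`-well-approximable numbers: the real `x` such that
`|x - r/q| ≤ |q|^{-(2+α)}` for infinitely many pairs `(q, r)` of integers (with `q ≠ 0`). -/
def wellApproxSet (α : ℝ) : Set ℝ :=
  {x : ℝ | {z : ℤ × ℤ | z.1 ≠ 0 ∧
    |x - (z.2 : ℝ) / (z.1 : ℝ)| ≤ |(z.1 : ℝ)| ^ (-(2 + α))}.Infinite}

/-- The Fourier transform `𝓕(μ)(ξ) = ∫ e^{-2πi x ξ} dμ(x)` of a measure on the line. -/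
noncomputable def fourierMeasure (μ : Measure ℝ) (ξ : ℝ) : ℂ :=
  ∫ x : ℝ, Complex.exp (-2 * (Real.pi : ℂ) * Complex.I * (x : ℂ) * (ξ : ℂ)) ∂μ

/-- The Fourier transform `𝓕(f μ)(ξ) = ∫ e^{-2πi x ξ} f(x) dμ(x)` of the measure `f μ`. -/
noncomputable def fourierDensity (f : ℝ → ℝ) (μ : Measure ℝ) (ξ : ℝ) : ℂ :=
  ∫ x : ℝ, Complex.exp (-2 * (Real.pi : ℂ) * Complex.I * (x : ℂ) * (ξ : ℂ)) * (f x : ℂ) ∂μ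

/-- The exponent `p₊(q) = (q/(q-1)) (1+α-β)/(1-β)` for `1 ≤ q ≤ ∞`. Here
`ENNReal.conjExponent q = 1 + (q-1)⁻¹` is the conjugate exponent `q/(q-1)`; it is `∞` at `q = 1`
and `1` at `q = ∞`. -/
noncomputable def pPlus (α β : ℝ) (q : ℝ≥0∞) : ℝ≥0∞ :=
  ENNReal.conjExponent q * ENNReal.ofReal ((1 + α - β) / (1 - β))

/-! The measure is a normalized weak limit of densities `g` on `[1/8, 3/8]`, each obtained from the
previous one by multiplying it with two periodic combs of mean one (`exists_step`).

The first comb (`exists_primeComb`) averages bumps of width about `Q^(-(2+α))` at the fractions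
`r/q`, with `q` running through the primes of a dyadic block `(Q, 2Q]` rich in primes. It forces the
support into `E(α)`. A nonzero frequency `n` is seen only by the few `q` dividing it, so the
coefficients decay like `|n|^(-1/(2+α))`. Distinct fractions are at least about `Q⁻²` apart and
carry mass about `Q⁻²` each, so the dimension is `2/(2+α)`; both hold up to arbitrarily small losses
in the exponents.

The second factor is `(1 - M) + M · comb` (`exists_arithComb`), where the comb sits on the
progression `N⁻¹ ℤ` with `N ≈ Q^(1+β)`, at width `δ = Q^(-(2+α))`, and has mass `M = Q^(-(1-β))`.
Its coefficients have size `M = δ^((1-β)/(2+α))` up to frequency `1/δ`, and each bump carries `M/N ≈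
Q⁻² = δ^(2/(2+α))`. So the planted structure exhausts exactly the allowed decay and regularity.

Both multiplications are harmless by `IsDens.exists_amplify`. The transform of a fixed smooth `g`
decays fast, so convolving it with small coefficients at high integer frequencies barely moves it.
Masses of long intervals are then controlled from the Fourier side, and those of short intervals by
the comb's own mass bound. As the parameter of the comb is chosen after `g`, the errors can be made
summable, and the exponent losses tend to zero along the construction. The mass on each progression
survives in the limit, because it is detected by a test function with absolutely summable
coefficients (`exists_le_measure_nearProgression`).

The functions `f_k` are the indicators of the neighbourhoods `A` of the planted progressions. On `A`
the phases at frequencies just above `jN` nearly agree, so `|𝓕(f_k μ)| ≥ μ(A)/2` on a set of measure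
about `Q^(1+α-β)` (`ofReal_le_eLpNorm_fourierDensity`). Since `‖f_k‖_q = μ(A)^(1/q)` and `μ(A) ≳
Q^(-(1-β))`, the quotient is at least a constant times `Q^((1+α-β)/p - (1-β)(1-1/q))`, and the
exponent is positive exactly when `p < p₊(q)`. -/

/-! ### A smooth bump and its periodization -/

/-- A fixed smooth bump, equal to `1` on `[-1, 1]` and supported in `[-2, 2]`. -/
noncomputable def bump : ContDiffBump (0 : ℝ) := ⟨1, 2, one_pos, one_lt_two⟩

lemma bump_eq_one {x : ℝ} (hx : |x| ≤ 1) : bump x = 1 :=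
  bump.one_of_mem_closedBall (by simpa [bump] using hx)

lemma bump_eq_zero {x : ℝ} (hx : 2 ≤ |x|) : bump x = 0 :=
  bump.zero_of_le_dist (by simpa [bump] using hx)

lemma continuous_bump : Continuous (fun x : ℝ => bump x) := bump.continuous

/-- The integral of `bump`. -/
noncomputable def bumpMass : ℝ := ∫ x, bump x

lemma bumpMass_pos : 0 < bumpMass := bump.integral_pos

/-- The Fourier transform of `bump`. -/
noncomputable def bumpHat (ξ : ℝ) : ℂ := FourierTransform.fourier (fun x : ℝ => (bump x : ℂ)) ξ

lemma bumpHat_eq (ξ : ℝ) :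
    bumpHat ξ = ∫ x : ℝ, Complex.exp (-2 * (Real.pi : ℂ) * Complex.I * x * ξ) * (bump x : ℂ) := by
  rw [bumpHat, Real.fourier_real_eq_integral_exp_smul]
  congr 1 with x
  rw [smul_eq_mul]
  congr 2
  push_cast
  ring

lemma bumpHat_zero : bumpHat 0 = bumpMass := by
  rw [bumpHat_eq, bumpMass, ← integral_complex_ofReal]
  simp

lemma contDiff_scaled_bump (w : ℝ) :
    ContDiff ℝ (⊤ : ℕ∞) (fun x : ℝ => ((bump (x / w) : ℝ) : ℂ)) :=
  Complex.ofRealCLM.contDiff.comp (bump.contDiff.comp (contDiff_id.div_const w))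

lemma hasCompactSupport_scaled_bump {w : ℝ} (hw : 0 < w) :
    HasCompactSupport (fun x : ℝ => ((bump (x / w) : ℝ) : ℂ)) := by
  refine HasCompactSupport.intro (K := Icc (-(2 * w)) (2 * w)) isCompact_Icc fun x hx => ?_
  rw [bump_eq_zero, Complex.ofReal_zero]
  rw [abs_div, abs_of_pos hw, le_div_iff₀ hw]
  by_contra! h
  exact hx (abs_le.1 h.le)

/-- A dilate of `bump` as a Schwartz function. -/
noncomputable def scaledBump (w : ℝ) (hw : 0 < w) : SchwartzMap ℝ ℂ :=
  (hasCompactSupport_scaled_bump hw).toSchwartzMap (contDiff_scaled_bump w)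

lemma fourier_scaledBump {w : ℝ} (hw : 0 < w) (ξ : ℝ) :
    FourierTransform.fourier (scaledBump w hw) ξ = w * bumpHat (w * ξ) := by
  rw [SchwartzMap.fourier_coe, Real.fourier_real_eq_integral_exp_smul, bumpHat_eq]
  have := Measure.integral_comp_div (fun x : ℝ =>
    Complex.exp (-2 * (Real.pi : ℂ) * Complex.I * x * (w * ξ : ℝ)) * (bump x : ℂ)) w
  rw [abs_of_pos hw, Complex.real_smul] at this
  rw [← this]
  congr 1 with x
  simp only [scaledBump, HasCompactSupport.toSchwartzMap_toFun, smul_eq_mul]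
  congr 2
  push_cast
  have : (w : ℂ) ≠ 0 := by exact_mod_cast hw.ne'
  field_simp

lemma SchwartzMap.exists_norm_le_div_pow (f : SchwartzMap ℝ ℂ) (k : ℕ) :
    ∃ C, 0 < C ∧ ∀ x, ‖f x‖ ≤ C / (1 + |x|) ^ k := by
  obtain ⟨C₀, hC₀, h₀⟩ := f.decay 0 0
  obtain ⟨C₁, hC₁, h₁⟩ := f.decay k 0
  refine ⟨2 ^ (k - 1) * (C₀ + C₁), by positivity, fun x => ?_⟩
  have h0 := h₀ x
  have h1 := h₁ x
  simp only [norm_iteratedFDeriv_zero, pow_zero, one_mul, Real.norm_eq_abs] at h0 h1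
  rw [le_div_iff₀ (by positivity)]
  have := add_pow_le (zero_le_one) (abs_nonneg x) k
  rw [one_pow] at this
  calc ‖f x‖ * (1 + |x|) ^ k ≤ ‖f x‖ * (2 ^ (k - 1) * (1 + |x| ^ k)) := by gcongr
    _ = 2 ^ (k - 1) * (‖f x‖ + |x| ^ k * ‖f x‖) := by ring
    _ ≤ _ := by gcongr

/-- The power five is three plus two: after the cubic weight in `IsTrig` a summable quadratic tail
remains. -/
lemma exists_norm_bumpHat_le :
    ∃ C, 0 < C ∧ ∀ ξ, ‖bumpHat ξ‖ ≤ C / (1 + |ξ|) ^ 5 := by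
  obtain ⟨C, hC, h⟩ :=
    (FourierTransform.fourier (scaledBump 1 one_pos)).exists_norm_le_div_pow 5
  refine ⟨C, hC, fun ξ => ?_⟩
  simpa [fourier_scaledBump] using h ξ

/-- The `1`-periodization of a dilate of `bump`. -/
noncomputable def perBump (w y : ℝ) : ℝ := bump ((y - round y) / w)

lemma perBump_nonneg (w y : ℝ) : 0 ≤ perBump w y := bump.nonneg

lemma perBump_le_one (w y : ℝ) : perBump w y ≤ 1 := bump.le_one

lemma perBump_eq_one {w y : ℝ} (hw : 0 < w) (h : |y - round y| ≤ w) : perBump w y = 1 :=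
  bump_eq_one (by rw [abs_div, abs_of_pos hw]; exact (div_le_one hw).2 h)

lemma perBump_eq_zero {w y : ℝ} (hw : 0 < w) (h : 2 * w ≤ |y - round y|) : perBump w y = 0 :=
  bump_eq_zero (by rw [abs_div, abs_of_pos hw]; exact (le_div_iff₀ hw).2 h)

lemma lt_of_perBump_ne_zero {w y : ℝ} (hw : 0 < w) (h : perBump w y ≠ 0) :
    |y - round y| < 2 * w := by
  by_contra! h'
  exact h (perBump_eq_zero hw h')

lemma perBump_of_abs_le {w y : ℝ} (h : |y| ≤ 1 / 4) : perBump w y = bump (y / w) := by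
  have : round y = 0 := by
    rw [round_eq_zero_iff]
    rw [abs_le] at h
    constructor <;> linarith
  simp [perBump, this]

lemma abs_sub_intCast_ge (y : ℝ) {n : ℤ} (hn : n ≠ round y) : 1 / 2 ≤ |y - n| := by
  have h1 := abs_sub_round y
  have h2 : (1 : ℝ) ≤ |(n : ℝ) - round y| := by
    have : (1 : ℤ) ≤ |n - round y| := Int.one_le_abs (sub_ne_zero.2 hn)
    exact_mod_cast this
  have h3 := abs_sub_le (n : ℝ) y (round y)
  rw [abs_sub_comm (n : ℝ) y] at h3
  linarith

/-! ### Rapidly convergent Fourier series of periodic functions -/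

lemma summable_one_div_one_add_abs_sq : Summable fun n : ℤ => 1 / (1 + |(n : ℝ)|) ^ 2 := by
  refine Summable.of_norm_bounded_eventually (g := fun n : ℤ => 1 / |(n : ℝ)| ^ (2 : ℝ)) ?_ ?_
  · exact (Real.summable_one_div_int_add_rpow 0 2 |>.2 one_lt_two |>.congr (by simp))
  · filter_upwards [(Set.finite_singleton (0 : ℤ)).compl_mem_cofinite] with n hn
    have hn' : (0 : ℝ) < |(n : ℝ)| := abs_pos.2 (by exact_mod_cast hn)
    rw [Real.norm_of_nonneg (by positivity), Real.rpow_two]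
    gcongr
    linarith

/-- The real function `F` is the sum of the Fourier series with coefficients `c`, which decay
fast enough for the series to be manipulated freely. -/
structure IsTrig (F : ℝ → ℝ) (c : ℤ → ℂ) : Prop where
  summable : Summable fun n : ℤ => ‖c n‖ * (1 + |(n : ℝ)|) ^ 3
  hasSum : ∀ x : ℝ, HasSum (fun n : ℤ => c n * Complex.exp (2 * Real.pi * Complex.I * n * x))
    (F x : ℂ)

lemma norm_bumpHat_scaled_le {C : ℝ} (hC : 0 < C) (hb : ∀ ξ, ‖bumpHat ξ‖ ≤ C / (1 + |ξ|) ^ 5)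
    {w : ℝ} (hw : 0 < w) (hw1 : w ≤ 1) (n : ℝ) :
    ‖bumpHat (w * n)‖ ≤ C / w ^ 5 / (1 + |n|) ^ 5 := by
  refine (hb _).trans ?_
  rw [div_div, ← mul_pow]
  gcongr
  rw [abs_mul, abs_of_pos hw]
  linarith

lemma norm_exp_two_pi_I (n : ℤ) (x : ℝ) :
    ‖Complex.exp (2 * Real.pi * Complex.I * n * x)‖ = 1 := by
  rw [show (2 * Real.pi * Complex.I * n * x : ℂ) = ((2 * Real.pi * n * x : ℝ) : ℂ) * Complex.I by
    push_cast; ring]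
  exact Complex.norm_exp_ofReal_mul_I _

lemma summable_perBump_coeff {w : ℝ} (hw : 0 < w) (hw1 : w ≤ 1) :
    Summable fun n : ℤ => ‖(w * bumpHat (w * n) : ℂ)‖ * (1 + |(n : ℝ)|) ^ 3 := by
  obtain ⟨C, hC, hb⟩ := exists_norm_bumpHat_le
  refine Summable.of_nonneg_of_le (fun n => by positivity) (fun n => ?_)
    (summable_one_div_one_add_abs_sq.mul_left (C / w ^ 5))
  rw [norm_mul, Complex.norm_real, Real.norm_of_nonneg hw.le]
  calc w * ‖bumpHat (w * n)‖ * (1 + |(n : ℝ)|) ^ 3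
      ≤ 1 * (C / w ^ 5 / (1 + |(n : ℝ)|) ^ 5) * (1 + |(n : ℝ)|) ^ 3 := by
        gcongr
        exact norm_bumpHat_scaled_le hC hb hw hw1 n
    _ = _ := by field_simp

lemma isTrig_of_summable_of_tsum {F : ℝ → ℝ} {c : ℤ → ℂ}
    (h : Summable fun n : ℤ => ‖c n‖ * (1 + |(n : ℝ)|) ^ 3)
    (hF : ∀ x : ℝ, ∑' n : ℤ, c n * Complex.exp (2 * Real.pi * Complex.I * n * x) = F x) :
    IsTrig F c := by
  refine ⟨h, fun x => ?_⟩
  rw [← hF x]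
  refine Summable.hasSum (Summable.of_norm_bounded h fun n => ?_)
  rw [norm_mul, norm_exp_two_pi_I, mul_one]
  exact le_mul_of_one_le_right (norm_nonneg _) (one_le_pow₀ (by linarith [abs_nonneg (n : ℝ)]))

/-- Poisson summation for the periodized bump. -/
lemma isTrig_perBump {w : ℝ} (hw : 0 < w) (hw' : w ≤ 1 / 4) :
    IsTrig (perBump w) (fun n : ℤ => (w * bumpHat (w * n) : ℂ)) := by
  refine isTrig_of_summable_of_tsum (summable_perBump_coeff hw (by linarith)) fun y => ?_
  have := (scaledBump w hw).tsum_eq_tsum_fourier y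
  -- Since `2 * w ≤ 1/2`, only the translate by the nearest integer contributes to the
  -- periodization.
  rw [tsum_eq_single (-round y)] at this
  · simp only [fourier_scaledBump] at this
    have h2 : scaledBump w hw (y + ((-round y : ℤ) : ℝ)) = (perBump w y : ℂ) := by
      simp [scaledBump, perBump, sub_eq_add_neg]
    rw [← h2, this]
    congr 1 with n
    rw [fourier_coe_apply]
    push_cast
    congr 2
    ring
  · intro n hn
    simp only [scaledBump, HasCompactSupport.toSchwartzMap_toFun]
    rw [bump_eq_zero, Complex.ofReal_zero]
    have := abs_sub_intCast_ge y (n := -n) (fun h => hn (by omega))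
    rw [abs_div, abs_of_pos hw, le_div_iff₀ hw]
    push_cast at this
    rw [sub_neg_eq_add] at this
    linarith

namespace IsTrig

variable {F F' : ℝ → ℝ} {c c' : ℤ → ℂ}

lemma summable_norm (h : IsTrig F c) : Summable fun n => ‖c n‖ :=
  Summable.of_nonneg_of_le (fun _ => norm_nonneg _) (fun n =>
    le_mul_of_one_le_right (norm_nonneg _) (one_le_pow₀ (by linarith [abs_nonneg (n : ℝ)])))
    h.summable

lemma continuous (h : IsTrig F c) : Continuous F := by
  have : Continuous fun x : ℝ => (F x : ℂ) := by
    have h1 : (fun x : ℝ => (F x : ℂ)) =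
        fun x : ℝ => ∑' n : ℤ, c n * Complex.exp (2 * Real.pi * Complex.I * n * x) :=
      funext fun x => (h.hasSum x).tsum_eq.symm
    rw [h1]
    refine continuous_tsum (fun n => by fun_prop) h.summable_norm fun n x => ?_
    rw [norm_mul, norm_exp_two_pi_I, mul_one]
  exact Complex.continuous_re.comp this |>.congr fun x => Complex.ofReal_re _

lemma add (h : IsTrig F c) (h' : IsTrig F' c') :
    IsTrig (fun x => F x + F' x) (fun n => c n + c' n) := by
  refine ⟨Summable.of_nonneg_of_le (fun n => by positivity) (fun n => ?_)
    (h.summable.add h'.summable), fun x => ?_⟩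
  · rw [← add_mul]
    gcongr
    exact norm_add_le _ _
  · push_cast
    simpa only [add_mul] using (h.hasSum x).add (h'.hasSum x)

lemma const_mul (h : IsTrig F c) (a : ℝ) :
    IsTrig (fun x => a * F x) (fun n => a * c n) := by
  refine ⟨?_, fun x => ?_⟩
  · simpa only [norm_mul, mul_assoc] using h.summable.mul_left ‖(a : ℂ)‖
  · push_cast
    simpa only [mul_assoc] using (h.hasSum x).mul_left (a : ℂ)

lemma sum {ι : Type*} {s : Finset ι} {F : ι → ℝ → ℝ} {c : ι → ℤ → ℂ}
    (h : ∀ i ∈ s, IsTrig (F i) (c i)) :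
    IsTrig (fun x => ∑ i ∈ s, F i x) (fun n => ∑ i ∈ s, c i n) := by
  classical
  induction s using Finset.induction_on with
  | empty => exact ⟨by simp, fun x => by simp⟩
  | insert a s ha ih =>
    simp only [Finset.sum_insert ha]
    exact (h a (Finset.mem_insert_self _ _)).add
      (ih fun i hi => h i (Finset.mem_insert_of_mem hi))

lemma const (a : ℝ) : IsTrig (fun _ => a) (fun n => if n = 0 then (a : ℂ) else 0) := by
  refine ⟨summable_of_ne_finset_zero (s := {0}) fun n hn => ?_, fun x => ?_⟩
  · rw [if_neg (by simpa using hn)]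
    simp
  · convert! hasSum_ite_eq (0 : ℤ) (a : ℂ) using 2 with n
    split_ifs with h <;> simp [h]

lemma translate (h : IsTrig F c) (a : ℝ) :
    IsTrig (fun x => F (x - a))
      (fun n => c n * Complex.exp (2 * Real.pi * Complex.I * n * (-a : ℝ))) := by
  refine ⟨?_, fun x => ?_⟩
  · simpa only [norm_mul, norm_exp_two_pi_I, mul_one] using h.summable
  · convert! h.hasSum (x - a) using 2 with n
    rw [mul_assoc, ← Complex.exp_add]
    congr 2
    push_cast
    ring

lemma dilate (h : IsTrig F c) {N : ℤ} (hN : N ≠ 0) :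
    IsTrig (fun x => F (N * x)) (fun n => if N ∣ n then c (n / N) else 0) := by
  have hc : Summable fun n : ℤ => ‖c n‖ * (1 + |(n * N : ℝ)|) ^ 3 := by
    refine Summable.of_nonneg_of_le (fun n => by positivity) (fun n => ?_)
      (h.summable.mul_left (|(N : ℝ)| ^ 3))
    rw [mul_left_comm, ← mul_pow, abs_mul]
    have : (1 : ℝ) ≤ |(N : ℝ)| := by exact_mod_cast Int.one_le_abs hN
    gcongr
    linarith
  have hinj : Function.Injective fun n : ℤ => n * N := fun a b hab => mul_right_cancel₀ hN hab
  have hr : ∀ n ∉ range (fun n : ℤ => n * N), ¬ N ∣ n := by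
    rintro n hn ⟨k, rfl⟩
    exact hn ⟨k, mul_comm _ _⟩
  refine ⟨?_, fun x => ?_⟩
  · rw [← hinj.summable_iff]
    · simpa [Function.comp_def, hN] using hc
    · intro n hn
      simp [hr n hn]
  · rw [← hinj.hasSum_iff]
    · convert! h.hasSum (N * x) using 2 with n
      simp only [Function.comp_apply, dvd_mul_left, if_true, Int.mul_ediv_cancel _ hN]
      congr 2
      push_cast
      ring
    · intro n hn
      simp [hr n hn]

end IsTrig

/-! ### Combs over sets of denominators -/

/-- The average over `q ∈ P` of the normalized bumps of width `δ` placed at the points of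
`q⁻¹ ℤ`. -/
noncomputable def comb (P : Finset ℕ) (δ x : ℝ) : ℝ :=
  (P.card : ℝ)⁻¹ * ∑ q ∈ P, (q * δ * bumpMass)⁻¹ * perBump (q * δ) (q * x)

/-- The Fourier coefficients of `comb P δ`. -/
noncomputable def combCoeff (P : Finset ℕ) (δ : ℝ) (n : ℤ) : ℂ :=
  ((P.card : ℝ)⁻¹ : ℝ) * ∑ q ∈ P, if (q : ℤ) ∣ n then bumpHat (δ * n) / bumpMass else 0

lemma comb_nonneg (P : Finset ℕ) {δ : ℝ} (hδ : 0 ≤ δ) (x : ℝ) : 0 ≤ comb P δ x :=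
  mul_nonneg (by positivity) (Finset.sum_nonneg fun q _ =>
    mul_nonneg (inv_nonneg.2 (mul_nonneg (by positivity) bumpMass_pos.le)) (perBump_nonneg _ _))

lemma isTrig_comb {P : Finset ℕ} {δ : ℝ} (hδ : 0 < δ) (hP : ∀ q ∈ P, 0 < q ∧ q * δ ≤ 1 / 4) :
    IsTrig (comb P δ) (combCoeff P δ) := by
  refine IsTrig.const_mul (IsTrig.sum fun q hq => ?_) _
  obtain ⟨hq0, hq1⟩ := hP q hq
  have hq0' : (0 : ℝ) < q := by exact_mod_cast hq0
  have hm := bumpMass_pos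
  convert! (((isTrig_perBump (by positivity : 0 < q * δ) hq1).dilate
    (N := q) (by exact_mod_cast hq0.ne')).const_mul (q * δ * bumpMass)⁻¹) using 2 with n n
  · split_ifs with h
    · obtain ⟨k, rfl⟩ := h
      rw [Int.mul_ediv_cancel_left _ (by exact_mod_cast hq0.ne')]
      have h1 : (q : ℂ) ≠ 0 := by exact_mod_cast hq0.ne'
      have h2 : (δ : ℂ) ≠ 0 := by exact_mod_cast hδ.ne'
      have h3 : (bumpMass : ℂ) ≠ 0 := by exact_mod_cast hm.ne'
      push_cast
      rw [show (δ * (q * k) : ℝ) = q * δ * k by ring]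
      field_simp
    · simp

lemma combCoeff_zero {P : Finset ℕ} (hP : P.Nonempty) (δ : ℝ) : combCoeff P δ 0 = 1 := by
  have h3 : (bumpMass : ℂ) ≠ 0 := by exact_mod_cast bumpMass_pos.ne'
  have h1 : (P.card : ℂ) ≠ 0 := by exact_mod_cast hP.card_ne_zero
  simp [combCoeff, bumpHat_zero, h3, h1]

/-- The comb of denominator `q` is `1/q`-periodic, hence only sees multiples of `q`. The gain over
the trivial bound is the proportion of `P` dividing `n`. -/
lemma norm_combCoeff_le (P : Finset ℕ) (δ : ℝ) (n : ℤ) :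
    ‖combCoeff P δ n‖ ≤
      (P.card : ℝ)⁻¹ * (P.filter fun q : ℕ => (q : ℤ) ∣ n).card *
        (‖bumpHat (δ * n)‖ / bumpMass) := by
  rw [combCoeff, ← Finset.sum_filter, Finset.sum_const, norm_mul, Complex.norm_real, nsmul_eq_mul,
    norm_mul, norm_div, Complex.norm_real, Real.norm_of_nonneg bumpMass_pos.le,
    Real.norm_of_nonneg (by positivity), ← mul_assoc]
  simp

/-! ### Fourier transforms of finite measures and of densities -/

lemma norm_exp_neg_two_pi_I (x ξ : ℝ) :
    ‖Complex.exp (-2 * (Real.pi : ℂ) * Complex.I * (x : ℂ) * (ξ : ℂ))‖ = 1 := by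
  rw [show (-2 * (Real.pi : ℂ) * Complex.I * x * ξ : ℂ) =
    ((-2 * Real.pi * x * ξ : ℝ) : ℂ) * Complex.I by push_cast; ring]
  exact Complex.norm_exp_ofReal_mul_I _

lemma fourierMeasure_zero (σ : Measure ℝ) : fourierMeasure σ 0 = σ.real univ := by
  simp [fourierMeasure]

lemma integrable_exp_neg_two_pi_I (σ : Measure ℝ) [IsFiniteMeasure σ] (ξ : ℝ) :
    Integrable (fun x : ℝ => Complex.exp (-2 * (Real.pi : ℂ) * Complex.I * (x : ℂ) * (ξ : ℂ))) σ :=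
  Integrable.of_bound (C := 1) (Continuous.aestronglyMeasurable (by fun_prop))
    (Filter.Eventually.of_forall fun x => (norm_exp_neg_two_pi_I x ξ).le)

/-- Parseval's identity for an absolutely convergent Fourier series and a finite measure. -/
lemma IsTrig.hasSum_integral {F : ℝ → ℝ} {c : ℤ → ℂ} (h : IsTrig F c) (σ : Measure ℝ)
    [IsFiniteMeasure σ] :
    HasSum (fun n : ℤ => c n * fourierMeasure σ (-n)) ((∫ x, F x ∂σ : ℝ) : ℂ) := by
  have h1 : ∀ n : ℤ, c n * fourierMeasure σ (-n) =
      ∫ x : ℝ, c n * Complex.exp (2 * Real.pi * Complex.I * n * x) ∂σ := by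
    intro n
    rw [fourierMeasure, integral_const_mul]
    congr 2 with x
    congr 1
    push_cast
    ring
  have h2 : ∀ n : ℤ, ∀ x : ℝ, ‖c n * Complex.exp (2 * Real.pi * Complex.I * n * x)‖ = ‖c n‖ := by
    intro n x
    rw [norm_mul, norm_exp_two_pi_I, mul_one]
  simp_rw [h1, ← integral_complex_ofReal]
  convert! hasSum_integral_of_summable_integral_norm (μ := σ)
    (F := fun (n : ℤ) (x : ℝ) => c n * Complex.exp (2 * Real.pi * Complex.I * n * x)) ?_ ?_ using 2
  · ext x
    exact (h.hasSum x).tsum_eq.symm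
  · intro n
    exact Integrable.of_bound (C := ‖c n‖) (Continuous.aestronglyMeasurable (by fun_prop))
      (Filter.Eventually.of_forall fun x => (h2 n x).le)
  · simp_rw [h2, integral_const, smul_eq_mul]
    exact h.summable_norm.mul_left _

/-- Uniform closeness in Fourier space is the only notion of perturbation used later; this converts
it into closeness of integrals. -/
lemma IsTrig.abs_integral_sub_le {F : ℝ → ℝ} {c : ℤ → ℂ} (h : IsTrig F c) (σ σ' : Measure ℝ)
    [IsFiniteMeasure σ] [IsFiniteMeasure σ'] {θ : ℝ}
    (hθ : ∀ ξ, ‖fourierMeasure σ ξ - fourierMeasure σ' ξ‖ ≤ θ) :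
    |∫ x, F x ∂σ - ∫ x, F x ∂σ'| ≤ (∑' n, ‖c n‖) * θ := by
  have h1 := (h.hasSum_integral σ).sub (h.hasSum_integral σ')
  rw [← Complex.ofReal_sub] at h1
  rw [← Real.norm_eq_abs, ← Complex.norm_real, ← h1.tsum_eq, ← tsum_mul_right]
  refine tsum_of_norm_bounded (h.summable_norm.mul_right θ).hasSum fun n => ?_
  rw [← mul_sub, norm_mul]
  gcongr
  exact hθ _

/-! ### Compactly supported densities and their products with periodic functions -/

/-- The measure with density `g`. -/
noncomputable def densMeasure (g : ℝ → ℝ) : Measure ℝ :=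
  volume.withDensity fun x => ENNReal.ofReal (g x)

/-- The interval carrying all our measures; it stays away from the integers. -/
def baseInterval : Set ℝ := Icc (1 / 8) (3 / 8)

/-- Continuous nonnegative densities on `baseInterval` whose Fourier transform decays. -/
structure IsDens (g : ℝ → ℝ) : Prop where
  cont : Continuous g
  nonneg : ∀ x, 0 ≤ g x
  eq_zero : ∀ x ∉ baseInterval, g x = 0
  decay : ∃ C, 0 < C ∧ ∀ ξ, ‖fourierMeasure (densMeasure g) ξ‖ ≤ C / (1 + |ξ|) ^ 3

lemma integral_densMeasure {E : Type*} [NormedAddCommGroup E] [NormedSpace ℝ E] {g : ℝ → ℝ}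
    (hg : Continuous g) (h0 : ∀ x, 0 ≤ g x) (f : ℝ → E) :
    ∫ x, f x ∂(densMeasure g) = ∫ x, g x • f x := by
  rw [densMeasure, integral_withDensity_eq_integral_toReal_smul
    (hg.measurable.ennreal_ofReal) (by simp)]
  simp_rw [ENNReal.toReal_ofReal (h0 _)]

namespace IsDens

variable {g : ℝ → ℝ}

lemma hasCompactSupport (hg : IsDens g) : HasCompactSupport g :=
  HasCompactSupport.intro isCompact_Icc hg.eq_zero

lemma integrable (hg : IsDens g) : Integrable g :=
  hg.cont.integrable_of_hasCompactSupport hg.hasCompactSupport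

lemma isFiniteMeasure (hg : IsDens g) : IsFiniteMeasure (densMeasure g) :=
  isFiniteMeasure_withDensity_ofReal hg.integrable.2

lemma integral_eq (hg : IsDens g) {E : Type*} [NormedAddCommGroup E] [NormedSpace ℝ E]
    (f : ℝ → E) : ∫ x, f x ∂(densMeasure g) = ∫ x, g x • f x :=
  integral_densMeasure hg.cont hg.nonneg f

lemma exists_bound (hg : IsDens g) : ∃ D, 0 < D ∧ ∀ x, g x ≤ D := by
  obtain ⟨D, hD⟩ := hg.cont.bounded_above_of_compact_support hg.hasCompactSupport
  refine ⟨max D 1, by positivity, fun x => ?_⟩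
  exact ((Real.le_norm_self _).trans (hD x)).trans (le_max_left _ _)

/-- Each character in the expansion of `F` shifts the transform of `g` by an integer, so the product
has a discrete convolution as its transform. -/
lemma hasSum_fourier_mul (hg : IsDens g) {F : ℝ → ℝ} {c : ℤ → ℂ} (hF : IsTrig F c)
    (hF0 : ∀ x, 0 ≤ F x) (ξ : ℝ) :
    HasSum (fun n : ℤ => c n * fourierMeasure (densMeasure g) (ξ - n))
      (fourierMeasure (densMeasure fun x => g x * F x) ξ) := by
  have := hg.isFiniteMeasure
  have h2 : ∀ n : ℤ, ∀ x : ℝ, ‖Complex.exp (-2 * (Real.pi : ℂ) * Complex.I * (x : ℂ) * (ξ : ℂ)) *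
      (c n * Complex.exp (2 * Real.pi * Complex.I * n * x))‖ = ‖c n‖ := by
    intro n x
    rw [norm_mul, norm_mul, norm_exp_two_pi_I, mul_one, norm_exp_neg_two_pi_I, one_mul]
  have h1 : ∀ n : ℤ, c n * fourierMeasure (densMeasure g) (ξ - n) =
      ∫ x : ℝ, Complex.exp (-2 * (Real.pi : ℂ) * Complex.I * (x : ℂ) * (ξ : ℂ)) *
        (c n * Complex.exp (2 * Real.pi * Complex.I * n * x)) ∂(densMeasure g) := by
    intro n
    rw [fourierMeasure, ← integral_const_mul]
    congr 1 with x
    rw [mul_left_comm, ← Complex.exp_add]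
    congr 2
    push_cast
    ring
  have h3 : fourierMeasure (densMeasure fun x => g x * F x) ξ = ∫ x : ℝ,
      Complex.exp (-2 * (Real.pi : ℂ) * Complex.I * (x : ℂ) * (ξ : ℂ)) * (F x : ℂ)
        ∂(densMeasure g) := by
    rw [fourierMeasure, integral_densMeasure (g := fun x => g x * F x) (hg.cont.mul hF.continuous)
      (fun x => mul_nonneg (hg.nonneg x) (hF0 x)), hg.integral_eq]
    congr 1 with x
    simp only [Complex.real_smul]
    push_cast
    ring
  simp_rw [h1, h3]
  convert! hasSum_integral_of_summable_integral_norm (μ := densMeasure g)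
    (F := fun (n : ℤ) (x : ℝ) => Complex.exp (-2 * (Real.pi : ℂ) * Complex.I * (x : ℂ) * (ξ : ℂ)) *
        (c n * Complex.exp (2 * Real.pi * Complex.I * n * x))) ?_ ?_ using 2
  · ext x
    exact ((hF.hasSum x).mul_left _).tsum_eq.symm
  · intro n
    exact Integrable.of_bound (C := ‖c n‖) (Continuous.aestronglyMeasurable (by fun_prop))
      (Filter.Eventually.of_forall fun x => (h2 n x).le)
  · simp_rw [h2, integral_const, smul_eq_mul]
    exact hF.summable_norm.mul_left _

/-- Peetre's inequality. -/
lemma _root_.one_add_abs_le_mul (ξ η : ℝ) : 1 + |ξ| ≤ (1 + |η|) * (1 + |ξ - η|) := by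
  have := abs_sub_abs_le_abs_sub ξ η
  nlinarith [abs_nonneg η, abs_nonneg (ξ - η)]

/-- The cubic weight in `IsTrig` matches the cubic decay in `IsDens`: by Peetre's inequality the
weight pays for the shift by `n`, so the construction can be iterated within the class. -/
lemma mul (hg : IsDens g) {F : ℝ → ℝ} {c : ℤ → ℂ} (hF : IsTrig F c) (hF0 : ∀ x, 0 ≤ F x) :
    IsDens fun x => g x * F x := by
  refine ⟨hg.cont.mul hF.continuous, fun x => mul_nonneg (hg.nonneg x) (hF0 x),
    fun x hx => by simp [hg.eq_zero x hx], ?_⟩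
  obtain ⟨C, hC, h⟩ := hg.decay
  refine ⟨(∑' n : ℤ, ‖c n‖ * (1 + |(n : ℝ)|) ^ 3) * C + 1, ?_, fun ξ => ?_⟩
  · have : 0 ≤ ∑' n : ℤ, ‖c n‖ * (1 + |(n : ℝ)|) ^ 3 := tsum_nonneg fun n => by positivity
    positivity
  · have h1 : ‖fourierMeasure (densMeasure fun x => g x * F x) ξ‖ ≤
        (∑' n : ℤ, ‖c n‖ * (1 + |(n : ℝ)|) ^ 3) * (C / (1 + |ξ|) ^ 3) := by
      rw [← (hg.hasSum_fourier_mul hF hF0 ξ).tsum_eq, ← tsum_mul_right]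
      refine tsum_of_norm_bounded (hF.summable.mul_right _).hasSum fun n => ?_
      rw [norm_mul, mul_assoc]
      gcongr
      refine (h _).trans ?_
      rw [← mul_div_assoc, div_le_div_iff₀ (by positivity) (by positivity), mul_comm _ C, mul_assoc,
        ← mul_pow]
      gcongr
      exact one_add_abs_le_mul ξ n
    refine h1.trans ?_
    rw [← mul_div_assoc]
    gcongr
    linarith

end IsDens

/-- The sum `∑ (1 + |ξ - n|)⁻²` is bounded uniformly in `ξ`. -/
lemma summable_shifted_and_le (ξ : ℝ) :
    (Summable fun n : ℤ => 1 / (1 + |ξ - n|) ^ 2) ∧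
      ∑' n : ℤ, 1 / (1 + |ξ - n|) ^ 2 ≤ 4 * ∑' n : ℤ, 1 / (1 + |(n : ℝ)|) ^ 2 := by
  have hs := summable_one_div_one_add_abs_sq
  have hs' : Summable fun n : ℤ => 4 * (1 / (1 + |((n - ⌊ξ⌋ : ℤ) : ℝ)|) ^ 2) :=
    ((Equiv.subRight ⌊ξ⌋).summable_iff.2 hs).mul_left 4
  have hle : ∀ n : ℤ, 1 / (1 + |ξ - n|) ^ 2 ≤ 4 * (1 / (1 + |((n - ⌊ξ⌋ : ℤ) : ℝ)|) ^ 2) := by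
    intro n
    rw [mul_one_div, div_le_div_iff₀ (by positivity) (by positivity), one_mul,
      show (4 : ℝ) = 2 ^ 2 by norm_num, ← mul_pow]
    gcongr
    push_cast
    have h1 := Int.floor_le ξ
    have h2 := Int.lt_floor_add_one ξ
    have h3 : |(n : ℝ) - ⌊ξ⌋| ≤ |ξ - n| + 1 := by
      rw [abs_le]
      constructor <;> cases abs_cases (ξ - n) <;> linarith
    linarith [abs_nonneg (ξ - n)]
  have hsum := Summable.of_nonneg_of_le (fun n => by positivity) hle hs'
  refine ⟨hsum, (hsum.tsum_le_tsum hle hs').trans_eq ?_⟩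
  rw [tsum_mul_left]
  congr 1
  exact (Equiv.subRight ⌊ξ⌋).tsum_eq fun n : ℤ => 1 / (1 + |(n : ℝ)|) ^ 2

/-- Multiplying a density by a periodic function of mean one with small Fourier coefficients
changes its Fourier transform little. -/
lemma IsDens.exists_fourier_mul_sub_le {g : ℝ → ℝ} (hg : IsDens g) :
    ∃ C, 0 < C ∧ ∀ (F : ℝ → ℝ) (c : ℤ → ℂ), IsTrig F c → (∀ x, 0 ≤ F x) → c 0 = 1 →
      ∀ θ s : ℝ, 0 ≤ θ → -1 ≤ s → s ≤ 1 →
        (∀ n : ℤ, n ≠ 0 → ‖c n‖ ≤ θ * (1 + |(n : ℝ)|) ^ (-s)) → ∀ ξ,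
        ‖fourierMeasure (densMeasure fun x => g x * F x) ξ - fourierMeasure (densMeasure g) ξ‖ ≤
          C * θ * (1 + |ξ|) ^ (-s) := by
  obtain ⟨C, hC, h⟩ := hg.decay
  set K := ∑' n : ℤ, 1 / (1 + |(n : ℝ)|) ^ 2 with hK
  have hK0 : 0 ≤ K := tsum_nonneg fun n => by positivity
  refine ⟨C * (4 * K) + 1, by positivity, fun F c hF hF0 hc0 θ s hθ hs hs1 hc ξ => ?_⟩
  have h1 := (hg.hasSum_fourier_mul hF hF0 ξ).sub
    (hasSum_ite_eq (0 : ℤ) (fourierMeasure (densMeasure g) ξ))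
  obtain ⟨h2, h3⟩ := summable_shifted_and_le ξ
  rw [← h1.tsum_eq]
  have key : ∀ n : ℤ, ‖c n * fourierMeasure (densMeasure g) (ξ - n) -
      (if n = 0 then fourierMeasure (densMeasure g) ξ else 0)‖ ≤
      C * θ * (1 + |ξ|) ^ (-s) * (1 / (1 + |ξ - n|) ^ 2) := by
    intro n
    split_ifs with hn
    · subst hn
      simp only [hc0, Int.cast_zero, sub_zero, one_mul, sub_self, norm_zero]
      positivity
    · rw [sub_zero, norm_mul]
      -- Of the three powers of decay of the transform of `g`, one transports the weight from `n` to
      -- `ξ`, which suffices because `|s| ≤ 1`. The other two make the sum over `n` converge.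
      have e2 : (1 + |(n : ℝ)|) ^ (-s) * (1 + |ξ - n|)⁻¹ ≤ (1 + |ξ|) ^ (-s) := by
        rw [← Real.rpow_neg_one]
        have hb : 1 ≤ 1 + |ξ - n| := by linarith [abs_nonneg (ξ - n)]
        rcases le_total 0 s with h0 | h0
        · calc (1 + |(n : ℝ)|) ^ (-s) * (1 + |ξ - n|) ^ (-1 : ℝ)
              ≤ (1 + |(n : ℝ)|) ^ (-s) * (1 + |ξ - n|) ^ (-s) := by
                gcongr
            _ = ((1 + |(n : ℝ)|) * (1 + |ξ - n|)) ^ (-s) :=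
                (Real.mul_rpow (by positivity) (by positivity)).symm
            _ ≤ _ := Real.rpow_le_rpow_of_nonpos (by positivity) (one_add_abs_le_mul _ _)
                (by linarith)
        · have h1 : 1 + |(n : ℝ)| ≤ (1 + |ξ|) * (1 + |ξ - n|) := by
            rw [abs_sub_comm]
            exact one_add_abs_le_mul n ξ
          calc (1 + |(n : ℝ)|) ^ (-s) * (1 + |ξ - n|) ^ (-1 : ℝ)
              ≤ ((1 + |ξ|) * (1 + |ξ - n|)) ^ (-s) * (1 + |ξ - n|) ^ (-1 : ℝ) := by
                gcongr
                linarith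
            _ = (1 + |ξ|) ^ (-s) * (1 + |ξ - n|) ^ (-s + -1) := by
                rw [Real.mul_rpow (by positivity) (by positivity), mul_assoc,
                  ← Real.rpow_add (by positivity)]
            _ ≤ (1 + |ξ|) ^ (-s) * 1 := by
                gcongr
                exact Real.rpow_le_one_of_one_le_of_nonpos hb (by linarith)
            _ = _ := mul_one _
      calc ‖c n‖ * ‖fourierMeasure (densMeasure g) (ξ - n)‖
          ≤ (θ * (1 + |(n : ℝ)|) ^ (-s)) * (C / (1 + |ξ - n|) ^ 3) := by
            gcongr
            · exact hc n hn
            · exact h _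
        _ = C * θ * ((1 + |(n : ℝ)|) ^ (-s) * (1 + |ξ - n|)⁻¹) * (1 / (1 + |ξ - n|) ^ 2) := by
            have : 1 + |ξ - n| ≠ 0 := by positivity
            field_simp
        _ ≤ _ := by gcongr
  refine (tsum_of_norm_bounded (h2.mul_left _).hasSum key).trans ?_
  rw [tsum_mul_left]
  calc _ ≤ C * θ * (1 + |ξ|) ^ (-s) * (4 * K) := by gcongr
    _ = C * (4 * K) * θ * (1 + |ξ|) ^ (-s) := by ring
    _ ≤ _ := by
      gcongr
      linarith

/-! ### Multiplying a density by a fine periodic function -/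

/-- The smoothed mass that `σ` gives to the interval of radius `r` around `c`. -/
noncomputable def bumpMean (σ : Measure ℝ) (c r : ℝ) : ℝ := ∫ x, perBump r (x - c) ∂σ

/-- Any fixed power of `1/r` would do: the bound is applied only for `r` at least a small negative
power of `L`, against a gain of `L⁻¹`. -/
lemma exists_tsum_perBump_coeff_le : ∃ B, 0 < B ∧ ∀ r : ℝ, 0 < r → r ≤ 1 →
    ∑' n : ℤ, ‖(r * bumpHat (r * n) : ℂ)‖ ≤ B / r ^ 4 := by
  obtain ⟨C, hC, hb⟩ := exists_norm_bumpHat_le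
  set K := ∑' n : ℤ, 1 / (1 + |(n : ℝ)|) ^ 2 with hK
  have hK0 : 0 ≤ K := tsum_nonneg fun n => by positivity
  refine ⟨C * K + 1, by positivity, fun r hr hr1 => ?_⟩
  have : ∑' n : ℤ, ‖(r * bumpHat (r * n) : ℂ)‖ ≤ C / r ^ 4 * K := by
    rw [hK, ← tsum_mul_left]
    refine Summable.tsum_le_tsum (fun n => ?_) ?_ (summable_one_div_one_add_abs_sq.mul_left _)
    · rw [norm_mul, Complex.norm_real, Real.norm_of_nonneg hr.le]
      calc r * ‖bumpHat (r * n)‖ ≤ r * (C / r ^ 5 / (1 + |(n : ℝ)|) ^ 5) := by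
            gcongr
            exact norm_bumpHat_scaled_le hC hb hr hr1 n
        _ = C / r ^ 4 * (1 / (1 + |(n : ℝ)|) ^ 5) := by field_simp
        _ ≤ C / r ^ 4 * (1 / (1 + |(n : ℝ)|) ^ 2) := by
            gcongr
            · linarith [abs_nonneg (n : ℝ)]
            · norm_num
    · refine Summable.of_nonneg_of_le (fun n => norm_nonneg _) (fun n => ?_)
        (summable_perBump_coeff hr hr1)
      exact le_mul_of_one_le_right (norm_nonneg _) (one_le_pow₀ (by linarith [abs_nonneg (n : ℝ)]))
  refine this.trans ?_
  rw [div_mul_eq_mul_div]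
  gcongr
  linarith

lemma abs_bumpMean_sub_le {B : ℝ} (hB : ∀ r : ℝ, 0 < r → r ≤ 1 →
    ∑' n : ℤ, ‖(r * bumpHat (r * n) : ℂ)‖ ≤ B / r ^ 4) (σ σ' : Measure ℝ) [IsFiniteMeasure σ]
    [IsFiniteMeasure σ'] {θ : ℝ} (hθ : ∀ ξ, ‖fourierMeasure σ ξ - fourierMeasure σ' ξ‖ ≤ θ)
    (c : ℝ) {r : ℝ} (hr : 0 < r) (hr1 : r ≤ 1 / 4) :
    |bumpMean σ c r - bumpMean σ' c r| ≤ B / r ^ 4 * θ := by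
  have hθ0 : 0 ≤ θ := (norm_nonneg _).trans (hθ 0)
  refine (((isTrig_perBump hr hr1).translate c).abs_integral_sub_le σ σ' hθ).trans ?_
  simp_rw [norm_mul _ (Complex.exp _), norm_exp_two_pi_I, mul_one]
  gcongr
  exact hB r hr (by linarith)

lemma abs_sub_le_of_mem_baseInterval {x c : ℝ} (hx : x ∈ baseInterval) (hc : c ∈ baseInterval) :
    |x - c| ≤ 1 / 4 := by
  obtain ⟨h1, h2⟩ := hx
  obtain ⟨h3, h4⟩ := hc
  rw [abs_le]
  constructor <;> linarith

/-- Bounding `g` by its supremum reduces the mass of a short interval to that of `F` alone. Points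
of `baseInterval` are within `1/4` of each other, so periodization creates no further copy of the
bump. -/
lemma bumpMean_mul_le {g F : ℝ → ℝ} (hg : IsDens g) (hgF : IsDens fun x => g x * F x)
    (hF : Continuous F) (hF0 : ∀ x, 0 ≤ F x) {D : ℝ} (hD : ∀ x, g x ≤ D) {c r : ℝ}
    (hc : c ∈ baseInterval) (hr : 0 < r) :
    bumpMean (densMeasure fun x => g x * F x) c r ≤
      D * ∫ x in Icc (c - 2 * r) (c + 2 * r) ∩ baseInterval, F x := by
  have hmeas : MeasurableSet (Icc (c - 2 * r) (c + 2 * r) ∩ baseInterval) :=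
    measurableSet_Icc.inter measurableSet_Icc
  rw [bumpMean, hgF.integral_eq, ← integral_const_mul, ← integral_indicator hmeas]
  have hint : Integrable ((Icc (c - 2 * r) (c + 2 * r) ∩ baseInterval).indicator
      fun x => D * F x) := by
    rw [integrable_indicator_iff hmeas]
    exact ((continuous_const.mul hF).integrableOn_Icc (a := c - 2 * r) (b := c + 2 * r)).mono_set
      inter_subset_left
  refine integral_mono_of_nonneg (Filter.Eventually.of_forall fun x => ?_) hint
    (Filter.Eventually.of_forall fun x => ?_)
  · exact smul_nonneg (hgF.nonneg x) (perBump_nonneg _ _)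
  · simp only [smul_eq_mul]
    by_cases hx : x ∈ Icc (c - 2 * r) (c + 2 * r) ∩ baseInterval
    · rw [indicator_of_mem hx]
      calc g x * F x * perBump r (x - c) ≤ g x * F x * 1 := by
            gcongr
            · exact hgF.nonneg x
            · exact perBump_le_one _ _
        _ ≤ D * F x := by
            rw [mul_one]
            gcongr
            · exact hF0 x
            · exact hD x
    · rw [indicator_of_notMem hx]
      by_cases hxJ : x ∈ baseInterval
      · rw [perBump_of_abs_le (abs_sub_le_of_mem_baseInterval hxJ hc), bump_eq_zero, mul_zero]
        rw [abs_div, abs_of_pos hr, le_div_iff₀ hr]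
        by_contra! h
        rw [abs_lt] at h
        exact hx ⟨⟨by linarith, by linarith⟩, hxJ⟩
      · simp [hg.eq_zero x hxJ]

/-- A density may be multiplied by any sufficiently fine periodic function `F` of mean one, at the
cost of arbitrarily small errors in Fourier space and in the masses of intervals. -/
lemma IsDens.exists_amplify {g : ℝ → ℝ} (hg : IsDens g) {A d s ε γ θ : ℝ} (hA : 0 < A)
    (hd1 : d ≤ 1) (hs0 : 0 ≤ s) (hs1 : s ≤ 1) (hε : 0 < ε) (hγ0 : 0 ≤ γ)
    (hγ : 20 * γ ≤ ε) (hθ : 0 < θ) :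
    ∃ L₀ : ℝ, 1 ≤ L₀ ∧ ∀ L : ℝ, L₀ ≤ L → ∀ (F : ℝ → ℝ) (c : ℤ → ℂ), IsTrig F c →
      (∀ x, 0 ≤ F x) → c 0 = 1 →
      (∀ n : ℤ, n ≠ 0 → ‖c n‖ ≤ A * L⁻¹ * (1 + |(n : ℝ)|) ^ (-s)) →
      (∀ x ∈ baseInterval, ∀ r : ℝ, 0 < r → r ≤ 1 / 4 →
        ∫ y in Icc (x - r) (x + r) ∩ baseInterval, F y ≤ A * L ^ γ * r ^ d) →
      IsDens (fun x => g x * F x) ∧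
      (∀ ξ, ‖fourierMeasure (densMeasure fun x => g x * F x) ξ - fourierMeasure (densMeasure g) ξ‖
        ≤ θ * (1 + |ξ|) ^ (-s)) ∧
      (∀ x ∈ baseInterval, ∀ r : ℝ, 0 < r → r ≤ 1 / 8 →
        bumpMean (densMeasure fun x => g x * F x) x r ≤
          bumpMean (densMeasure g) x r + θ * r ^ (d - ε)) := by
  obtain ⟨C, hC, hdiff⟩ := hg.exists_fourier_mul_sub_le
  obtain ⟨D, hD, hgD⟩ := hg.exists_bound
  obtain ⟨B, hB, hBr⟩ := exists_tsum_perBump_coeff_le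
  have lim : ∀ (a : ℝ) {b : ℝ}, 0 < b → ∀ᶠ L : ℝ in Filter.atTop, a * L ^ (-b) ≤ θ := by
    intro a b hb
    have := (tendsto_rpow_neg_atTop hb).const_mul a
    rw [mul_zero] at this
    exact this.eventually (ge_mem_nhds hθ)
  obtain ⟨L₀, hL₀⟩ := Filter.eventually_atTop.1
    (((lim (C * A) one_pos).and (lim (B * (C * A)) (b := 1 / 2) (by norm_num))).and
      (lim (2 * D * A) (b := ε / 20) (by positivity)))
  refine ⟨max L₀ 1, le_max_right _ _, fun L hL F c hF hF0 hc0 hc hI => ?_⟩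
  obtain ⟨⟨l1, l2⟩, l3⟩ := hL₀ L ((le_max_left _ _).trans hL)
  have hL1 : 1 ≤ L := (le_max_right _ _).trans hL
  have hLpos : 0 < L := by linarith
  rw [Real.rpow_neg_one] at l1
  have hgF := hg.mul hF hF0
  have := hg.isFiniteMeasure
  have := hgF.isFiniteMeasure
  have hf : ∀ ξ, ‖fourierMeasure (densMeasure fun x => g x * F x) ξ -
      fourierMeasure (densMeasure g) ξ‖ ≤ C * (A * L⁻¹) * (1 + |ξ|) ^ (-s) :=
    hdiff F c hF hF0 hc0 (A * L⁻¹) s (by positivity) (by linarith) hs1 hc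
  have hone : ∀ ξ : ℝ, (1 + |ξ|) ^ (-s) ≤ 1 := fun ξ =>
    Real.rpow_le_one_of_one_le_of_nonpos (by linarith [abs_nonneg ξ]) (by linarith)
  refine ⟨hgF, fun ξ => (hf ξ).trans ?_, fun x hx r hr hr8 => ?_⟩
  · gcongr
    linarith
  -- Below the threshold, `L ^ γ ≤ r ^ (-10γ) ≤ r ^ (-ε/2)` by `20γ ≤ ε`, and half of the loss `ε`
  -- remains to produce a negative power of `L`. Above it, `r ^ 5 ≥ L ^ (-1/2)`, so the Fourier gain
  -- `L⁻¹` beats the factor `r ^ (-4)`.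
  · rcases le_total r (L ^ (-(1 / 10) : ℝ)) with h | h
    · have hLr : L ^ γ ≤ r ^ (-(ε / 2)) := by
        have h1 : L ≤ r ^ (-10 : ℝ) := by
          have := Real.rpow_le_rpow_of_nonpos hr h (by norm_num : (-10 : ℝ) ≤ 0)
          rwa [← Real.rpow_mul hLpos.le, show (-(1 / 10) * -10 : ℝ) = 1 by norm_num,
            Real.rpow_one] at this
        calc L ^ γ ≤ (r ^ (-10 : ℝ)) ^ γ := Real.rpow_le_rpow hLpos.le h1 hγ0
          _ = r ^ (-10 * γ) := by rw [← Real.rpow_mul hr.le]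
          _ ≤ _ := Real.rpow_le_rpow_of_exponent_ge hr (by linarith) (by linarith)
      have h2 : r ^ (ε / 2) ≤ L ^ (-(ε / 20)) := by
        have := Real.rpow_le_rpow hr.le h (by positivity : 0 ≤ ε / 2)
        rwa [← Real.rpow_mul hLpos.le, show (-(1 / 10) * (ε / 2) : ℝ) = -(ε / 20) by ring] at this
      have h3 : (2 * r) ^ d ≤ 2 * r ^ d := by
        rw [Real.mul_rpow two_pos.le hr.le]
        gcongr
        simpa using Real.rpow_le_rpow_of_exponent_le (one_le_two : (1 : ℝ) ≤ 2) hd1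
      have h4 : 0 ≤ bumpMean (densMeasure g) x r := integral_nonneg fun y => perBump_nonneg _ _
      have h5 : r ^ (-(ε / 2)) * r ^ d = r ^ (ε / 2) * r ^ (d - ε) := by
        rw [← Real.rpow_add hr, ← Real.rpow_add hr]
        ring_nf
      calc bumpMean (densMeasure fun x => g x * F x) x r
          ≤ D * ∫ y in Icc (x - 2 * r) (x + 2 * r) ∩ baseInterval, F y :=
            bumpMean_mul_le hg hgF hF.continuous hF0 hgD hx hr
        _ ≤ D * (A * L ^ γ * (2 * r) ^ d) := by
            gcongr
            exact hI x hx (2 * r) (by linarith) (by linarith)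
        _ ≤ D * (A * r ^ (-(ε / 2)) * (2 * r ^ d)) := by gcongr
        _ = 2 * D * A * (r ^ (-(ε / 2)) * r ^ d) := by ring
        _ = 2 * D * A * r ^ (ε / 2) * r ^ (d - ε) := by rw [h5]; ring
        _ ≤ 2 * D * A * L ^ (-(ε / 20)) * r ^ (d - ε) := by gcongr
        _ ≤ θ * r ^ (d - ε) := by gcongr
        _ ≤ _ := by linarith
    · have h1 := abs_bumpMean_sub_le hBr (densMeasure fun x => g x * F x) (densMeasure g)
        (θ := C * (A * L⁻¹)) (fun ξ => (hf ξ).trans (mul_le_of_le_one_right (by positivity) (hone ξ)))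
        x hr (by linarith)
      have h2 : B / r ^ 4 * (C * (A * L⁻¹)) ≤ θ * r ^ (d - ε) := by
        have e1 : r ≤ r ^ (d - ε) := by
          simpa using Real.rpow_le_rpow_of_exponent_ge hr (by linarith) (by linarith : d - ε ≤ 1)
        have e2 : L ^ (-(1 / 2) : ℝ) ≤ r ^ 5 := by
          have := pow_le_pow_left₀ (by positivity) h 5
          rwa [← Real.rpow_natCast, ← Real.rpow_mul hLpos.le,
            show (-(1 / 10) * ((5 : ℕ) : ℝ) : ℝ) = -(1 / 2) by norm_num] at this
        have e3 : L⁻¹ = L ^ (-(1 / 2) : ℝ) * L ^ (-(1 / 2) : ℝ) := by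
          rw [← Real.rpow_add hLpos, ← Real.rpow_neg_one]
          norm_num
        calc B / r ^ 4 * (C * (A * L⁻¹))
            = (B * (C * A) * L ^ (-(1 / 2) : ℝ)) * L ^ (-(1 / 2) : ℝ) / r ^ 4 := by
              rw [e3]; ring
          _ ≤ θ * r ^ 5 / r ^ 4 := by gcongr
          _ = θ * r := by field_simp
          _ ≤ _ := by gcongr
      linarith [(abs_le.1 h1).2]

/-! ### Masses of intervals under combs -/

/-- Pigeonhole: cutting the interval into cells of length `d`, each cell contains at most one point.
-/
lemma card_le_of_separated {ι : Type*} (S : Finset ι) (f : ι → ℝ) {a l d : ℝ} (hl : 0 ≤ l)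
    (hd : 0 < d) (hf : ∀ i ∈ S, f i ∈ Icc a (a + l))
    (hsep : ∀ i ∈ S, ∀ j ∈ S, i ≠ j → d ≤ |f i - f j|) : (S.card : ℝ) ≤ 1 + l / d := by
  have h : S.card ≤ (Finset.range (⌊l / d⌋₊ + 1)).card := by
    refine Finset.card_le_card_of_injOn (fun i => ⌊(f i - a) / d⌋₊) (fun i hi => ?_) ?_
    · rw [Finset.mem_coe, Finset.mem_range, Nat.lt_succ_iff]
      refine Nat.floor_le_floor ?_
      gcongr
      linarith [(hf i hi).2]
    · intro i hi j hj hij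
      by_contra hne
      have h1 := hsep i hi j hj hne
      have hi0 : 0 ≤ (f i - a) / d := div_nonneg (by linarith [(hf i hi).1]) hd.le
      have hj0 : 0 ≤ (f j - a) / d := div_nonneg (by linarith [(hf j hj).1]) hd.le
      have a1 := Nat.floor_le hi0
      have a2 := Nat.lt_floor_add_one ((f i - a) / d)
      have b1 := Nat.floor_le hj0
      have b2 := Nat.lt_floor_add_one ((f j - a) / d)
      simp only at hij
      rw [hij] at a1 a2
      have h2 : |(f i - a) / d - (f j - a) / d| < 1 := by
        rw [abs_lt]
        constructor <;> linarith
      rw [← sub_div, abs_div, abs_of_pos hd, div_lt_one hd] at h2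
      rw [show f i - a - (f j - a) = f i - f j by ring] at h2
      linarith
  rw [Finset.card_range] at h
  calc (S.card : ℝ) ≤ ((⌊l / d⌋₊ + 1 : ℕ) : ℝ) := by exact_mod_cast h
    _ ≤ _ := by
      push_cast
      linarith [Nat.floor_le (div_nonneg hl hd.le)]

lemma setIntegral_bump_le {δ ρ : ℝ} (hδ : 0 < δ) (hρ : 0 < ρ) (c a : ℝ) {s : Set ℝ}
    (hs : s ⊆ Icc (c - ρ) (c + ρ)) :
    ∫ x in s, bump ((x - a) / δ) ≤ min (δ * bumpMass) (2 * ρ) := by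
  have hcs : HasCompactSupport fun x : ℝ => bump ((x - a) / δ) := by
    refine HasCompactSupport.intro (K := Icc (a - 2 * δ) (a + 2 * δ)) isCompact_Icc fun x hx => ?_
    refine bump_eq_zero ?_
    rw [abs_div, abs_of_pos hδ, le_div_iff₀ hδ]
    by_contra! h
    rw [abs_lt] at h
    exact hx ⟨by linarith, by linarith⟩
  have hcont : Continuous fun x : ℝ => bump ((x - a) / δ) :=
    continuous_bump.comp (by fun_prop)
  have hint : Integrable fun x : ℝ => bump ((x - a) / δ) :=
    hcont.integrable_of_hasCompactSupport hcs
  refine le_min ?_ ?_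
  · calc ∫ x in s, bump ((x - a) / δ) ≤ ∫ x, bump ((x - a) / δ) :=
          setIntegral_le_integral hint (Filter.Eventually.of_forall fun x => bump.nonneg)
      _ = δ * bumpMass := by
          rw [integral_sub_right_eq_self (fun x => bump (x / δ)),
            Measure.integral_comp_div (fun x => bump x), abs_of_pos hδ, smul_eq_mul, bumpMass]
  · calc ∫ x in s, bump ((x - a) / δ) ≤ ∫ x in Icc (c - ρ) (c + ρ), bump ((x - a) / δ) :=
          setIntegral_mono_set hint.integrableOn
            (Filter.Eventually.of_forall fun x => bump.nonneg) hs.eventuallyLE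
      _ ≤ ∫ x in Icc (c - ρ) (c + ρ), (1 : ℝ) :=
          setIntegral_mono hint.integrableOn (by simp) fun x => bump.le_one
      _ = 2 * ρ := by
          simp
          rw [max_eq_left (by linarith)]
          ring

/-- The first factor counts the bumps that can meet the interval: their centres lie in its
enlargement by `2δ` and are `d`-separated. The second bounds the contribution of a single bump, by
its total mass or by its height times the length. -/
lemma setIntegral_comb_le {P : Finset ℕ} {δ Q d ρ : ℝ} (hδ : 0 < δ) (hδ' : δ ≤ 1 / 32)
    (hQ : 0 < Q) (hP : ∀ q ∈ P, Q ≤ q) (hd : 0 < d)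
    (hsep : ∀ q ∈ P, ∀ q' ∈ P, ∀ r r' : ℤ, 0 < r → r < q → 0 < r' → r' < q' → (q, r) ≠ (q', r') →
      d ≤ |(r : ℝ) / q - r' / q'|) (c : ℝ) (hρ : 0 < ρ) :
    ∫ x in Icc (c - ρ) (c + ρ) ∩ baseInterval, comb P δ x ≤
      (1 + (2 * ρ + 4 * δ) / d) *
        ((P.card : ℝ)⁻¹ * ((Q * δ * bumpMass)⁻¹ * min (δ * bumpMass) (2 * ρ))) := by
  set I := Icc (c - ρ) (c + ρ) ∩ baseInterval with hI
  have hImeas : MeasurableSet I := measurableSet_Icc.inter measurableSet_Icc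
  have hm := bumpMass_pos
  set T : ℕ → Finset ℤ := fun q =>
    (Finset.Ioo (0 : ℤ) q).filter fun r => |(r : ℝ) / q - c| ≤ ρ + 2 * δ with hT
  set S := P.sigma T with hS
  have hcard : (S.card : ℝ) ≤ 1 + (2 * ρ + 4 * δ) / d := by
    refine card_le_of_separated S (fun i => (i.2 : ℝ) / i.1) (a := c - (ρ + 2 * δ))
      (by positivity) hd ?_ ?_
    · rintro ⟨q, r⟩ hqr
      simp only [hS, hT, Finset.mem_sigma, Finset.mem_filter, Finset.mem_Ioo, abs_le] at hqr
      exact ⟨by linarith, by linarith⟩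
    · rintro ⟨q, r⟩ hqr ⟨q', r'⟩ hqr' hne
      simp only [hS, hT, Finset.mem_sigma, Finset.mem_filter, Finset.mem_Ioo] at hqr hqr'
      refine hsep q hqr.1 q' hqr'.1 r r' hqr.2.1.1 hqr.2.1.2 hqr'.2.1.1 hqr'.2.1.2 ?_
      rintro h
      simp only [Prod.mk.injEq] at h
      obtain ⟨rfl, rfl⟩ := h
      exact hne rfl
  have hq0 : ∀ q ∈ P, (0 : ℝ) < q := fun q hq => hQ.trans_le (hP q hq)
  have hpt : ∀ x ∈ I, comb P δ x ≤
      ∑ i ∈ S, (P.card : ℝ)⁻¹ * ((i.1 * δ * bumpMass)⁻¹ * bump ((x - i.2 / i.1) / δ)) := by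
    intro x hx
    rw [comb, ← Finset.mul_sum, hS, Finset.sum_sigma]
    gcongr with q hq
    have hq := hq0 q hq
    simp only
    rw [← Finset.mul_sum]
    gcongr
    by_cases h0 : perBump (q * δ) (q * x) = 0
    · rw [h0]
      exact Finset.sum_nonneg fun _ _ => bump.nonneg
    · have h1 := lt_of_perBump_ne_zero (by positivity) h0
      have h2 : ((q : ℝ) * x - round ((q : ℝ) * x)) / (q * δ) =
          (x - round ((q : ℝ) * x) / q) / δ := by
        field_simp
      have h3 : |x - round ((q : ℝ) * x) / q| < 2 * δ := by
        rw [show x - round ((q : ℝ) * x) / q = ((q : ℝ) * x - round ((q : ℝ) * x)) / q by field_simp,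
          abs_div, abs_of_pos hq, div_lt_iff₀ hq]
        linarith
      -- The centre is within `2δ ≤ 1/16` of a point of `[1/8, 3/8]`, hence strictly between `0` and
      -- `1`. This excludes the fractions `0/q`, which coincide for all `q` and would violate
      -- separation.
      have h4 : round ((q : ℝ) * x) ∈ T q := by
        obtain ⟨⟨x1, x2⟩, x3, x4⟩ := hx
        rw [abs_lt] at h3
        simp only [hT, Finset.mem_filter, Finset.mem_Ioo]
        have p1 : (0 : ℝ) < round ((q : ℝ) * x) / q := by linarith
        have p2 : (round ((q : ℝ) * x) : ℝ) / q < 1 := by linarith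
        refine ⟨⟨?_, ?_⟩, ?_⟩
        · exact_mod_cast (div_pos_iff_of_pos_right hq).1 p1
        · exact_mod_cast (div_lt_one hq).1 p2
        · rw [abs_le]
          constructor <;> linarith
      rw [perBump, h2]
      exact Finset.single_le_sum (f := fun r : ℤ => bump ((x - r / q) / δ))
        (fun _ _ => bump.nonneg) h4
  have hbint : ∀ a : ℝ, IntegrableOn (fun x => bump ((x - a) / δ)) I := fun a =>
    ((continuous_bump.comp (by fun_prop : Continuous fun x : ℝ => (x - a) / δ)).integrableOn_Icc
      (a := c - ρ) (b := c + ρ)).mono_set inter_subset_left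
  calc ∫ x in I, comb P δ x
      ≤ ∫ x in I, ∑ i ∈ S, (P.card : ℝ)⁻¹ *
          ((i.1 * δ * bumpMass)⁻¹ * bump ((x - i.2 / i.1) / δ)) := by
        refine integral_mono_of_nonneg (Filter.Eventually.of_forall fun x => comb_nonneg P hδ.le x)
          ?_ ((ae_restrict_iff' hImeas).2 (Filter.Eventually.of_forall hpt))
        exact integrable_finsetSum _ fun i _ => ((hbint _).const_mul _).const_mul _
    _ = ∑ i ∈ S, (P.card : ℝ)⁻¹ *
          ((i.1 * δ * bumpMass)⁻¹ * ∫ x in I, bump ((x - i.2 / i.1) / δ)) := by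
        rw [integral_finsetSum _ fun i _ => ((hbint _).const_mul _).const_mul _]
        simp_rw [integral_const_mul]
    _ ≤ ∑ i ∈ S, (P.card : ℝ)⁻¹ * ((Q * δ * bumpMass)⁻¹ * min (δ * bumpMass) (2 * ρ)) := by
        gcongr with i hi
        · exact integral_nonneg fun _ => bump.nonneg
        · exact hP _ (Finset.mem_sigma.1 hi).1
        · exact setIntegral_bump_le hδ hρ c _ inter_subset_left
    _ = S.card * ((P.card : ℝ)⁻¹ * ((Q * δ * bumpMass)⁻¹ * min (δ * bumpMass) (2 * ρ))) := by
        rw [Finset.sum_const, nsmul_eq_mul]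
    _ ≤ _ := by gcongr

/-! ### The two kinds of combs -/

/-- Since the reciprocals of the primes are not summable, infinitely many dyadic blocks contain
many primes. -/
lemma exists_many_primes {κ : ℝ} (hκ : 0 < κ) (X : ℕ) :
    ∃ Q : ℕ, X ≤ Q ∧ 1 ≤ Q ∧
      (Q : ℝ) ^ (1 - κ) ≤ ((Finset.Ioc Q (2 * Q)).filter Nat.Prime).card := by
  by_contra! hcon
  refine not_summable_one_div_on_primes ?_
  obtain ⟨m₀, hm₀⟩ := pow_unbounded_of_one_lt X one_lt_two
  set f : ℕ → ℝ := indicator {p | p.Prime} fun n : ℕ => 1 / (n : ℝ) with hf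
  have hf0 : ∀ n, 0 ≤ f n := fun n => indicator_nonneg (fun _ _ => by positivity) _
  -- If every late dyadic block had fewer than `2^(m(1-κ))` primes, their reciprocals would add up
  -- to at most `2^(-κm)` per block, and the sum over all primes would be dominated by a geometric
  -- series.
  have hblock : ∀ m, m₀ ≤ m → ∑ n ∈ Finset.Ioc (2 ^ m) (2 ^ (m + 1)), f n ≤
      ((2 : ℝ) ^ (-κ)) ^ m := by
    intro m hm
    have hQ := hcon (2 ^ m) (hm₀.le.trans (Nat.pow_le_pow_right two_pos hm)) Nat.one_le_two_pow
    rw [← pow_succ'] at hQ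
    calc ∑ n ∈ Finset.Ioc (2 ^ m) (2 ^ (m + 1)), f n
        = ∑ n ∈ (Finset.Ioc (2 ^ m) (2 ^ (m + 1))).filter Nat.Prime, 1 / (n : ℝ) := by
          rw [Finset.sum_filter]
          exact Finset.sum_congr rfl fun n _ => by simp [hf, indicator_apply]
      _ ≤ ∑ n ∈ (Finset.Ioc (2 ^ m) (2 ^ (m + 1))).filter Nat.Prime, 1 / (2 : ℝ) ^ m := by
          gcongr with n hn
          have := (Finset.mem_Ioc.1 (Finset.mem_filter.1 hn).1).1
          exact_mod_cast this.le
      _ = ((Finset.Ioc (2 ^ m) (2 ^ (m + 1))).filter Nat.Prime).card * (1 / (2 : ℝ) ^ m) := by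
          rw [Finset.sum_const, nsmul_eq_mul]
      _ ≤ ((2 ^ m : ℕ) : ℝ) ^ (1 - κ) * (1 / (2 : ℝ) ^ m) := by gcongr
      _ = ((2 : ℝ) ^ (-κ)) ^ m := by
          push_cast
          rw [← Real.rpow_natCast, ← Real.rpow_natCast, ← Real.rpow_mul two_pos.le,
            ← Real.rpow_mul two_pos.le, one_div, ← Real.rpow_neg two_pos.le,
            ← Real.rpow_add two_pos]
          ring_nf
  have hr0 : (0 : ℝ) ≤ 2 ^ (-κ) := by positivity
  have hr1 : (2 : ℝ) ^ (-κ) < 1 := Real.rpow_lt_one_of_one_lt_of_neg one_lt_two (by linarith)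
  have hgeo := summable_geometric_of_lt_one hr0 hr1
  refine summable_of_sum_range_le (c := ∑ n ∈ Finset.range (2 ^ m₀ + 1), f n +
    ∑' m : ℕ, ((2 : ℝ) ^ (-κ)) ^ m) hf0 fun n => ?_
  have hind : ∀ k, ∑ i ∈ Finset.range (2 ^ (m₀ + k) + 1), f i ≤
      ∑ i ∈ Finset.range (2 ^ m₀ + 1), f i + ∑ j ∈ Finset.range k, ((2 : ℝ) ^ (-κ)) ^ (m₀ + j) := by
    intro k
    induction k with
    | zero => simp
    | succ k ih =>
      have hsplit : Finset.range (2 ^ (m₀ + (k + 1)) + 1) =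
          Finset.range (2 ^ (m₀ + k) + 1) ∪ Finset.Ioc (2 ^ (m₀ + k)) (2 ^ (m₀ + k + 1)) := by
        ext i
        have : 2 ^ (m₀ + k) ≤ 2 ^ (m₀ + k + 1) := Nat.pow_le_pow_right two_pos (by omega)
        simp only [Finset.mem_union, Finset.mem_range, Finset.mem_Ioc, ← add_assoc]
        omega
      rw [hsplit, Finset.sum_union, Finset.sum_range_succ _ k]
      · have := hblock (m₀ + k) (by omega)
        linarith
      · rw [Finset.disjoint_left]
        intro i hi hi'
        rw [Finset.mem_range] at hi
        rw [Finset.mem_Ioc] at hi'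
        omega
  calc ∑ i ∈ Finset.range n, f i ≤ ∑ i ∈ Finset.range (2 ^ (m₀ + n) + 1), f i := by
        refine Finset.sum_le_sum_of_subset_of_nonneg (Finset.range_mono ?_) fun _ _ _ => hf0 _
        have h1 : n < 2 ^ n := Nat.lt_two_pow_self
        have h2 : 2 ^ n ≤ 2 ^ (m₀ + n) := Nat.pow_le_pow_right two_pos (by omega)
        omega
    _ ≤ _ := hind n
    _ ≤ _ := by
        gcongr
        rw [← Finset.sum_image (s := Finset.range n) (g := fun j => m₀ + j)
          (f := fun j => ((2 : ℝ) ^ (-κ)) ^ j) (by intro a _ b _ h; simpa using h)]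
        exact hgeo.sum_le_tsum _ fun _ _ => by positivity

/-- The product of the prime divisors of `n` divides `n`, so their number is at most `log₂ |n|`,
which is below any power. -/
lemma card_prime_dvd_le {P : Finset ℕ} (hP : ∀ q ∈ P, q.Prime) {n : ℤ} (hn : n ≠ 0) {η : ℝ}
    (hη : 0 < η) :
    ((P.filter fun q : ℕ => (q : ℤ) ∣ n).card : ℝ) ≤ |(n : ℝ)| ^ η / (η * Real.log 2) := by
  set T := P.filter fun q : ℕ => (q : ℤ) ∣ n with hT
  have h1 : ∏ q ∈ T, q ∣ n.natAbs := by
    refine Finset.prod_primes_dvd _ (fun q hq => ?_) fun q hq => ?_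
    · exact (hP q (Finset.mem_filter.1 hq).1).prime
    · exact Int.natCast_dvd.1 (Finset.mem_filter.1 hq).2
  have h2 : 2 ^ T.card ≤ n.natAbs := by
    refine le_trans ?_ (Nat.le_of_dvd (Int.natAbs_pos.2 hn) h1)
    exact Finset.pow_card_le_prod _ _ _ fun q hq => (hP q (Finset.mem_filter.1 hq).1).two_le
  have h3 : (2 : ℝ) ^ T.card ≤ |(n : ℝ)| := by
    rw [← Int.cast_abs, Int.abs_eq_natAbs]
    exact_mod_cast h2
  have h4 := Real.log_le_log (by positivity) h3
  rw [Real.log_pow] at h4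
  have h5 := Real.log_le_rpow_div (abs_nonneg (n : ℝ)) hη
  have hl : 0 < Real.log 2 := Real.log_pos one_lt_two
  rw [← div_div, le_div_iff₀ hl]
  linarith

lemma min_one_div_le_rpow {d x y : ℝ} (hd0 : 0 ≤ d) (hd1 : d ≤ 1) (hx : 0 < x) (hy : 0 < y) :
    x⁻¹ * min x y ≤ (y / x) ^ d := by
  rcases le_total (y / x) 1 with h | h
  · calc x⁻¹ * min x y ≤ x⁻¹ * y := by
          gcongr
          exact min_le_right _ _
      _ = (y / x) ^ (1 : ℝ) := by rw [Real.rpow_one, div_eq_inv_mul]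
      _ ≤ _ := Real.rpow_le_rpow_of_exponent_ge (by positivity) h hd1
  · calc x⁻¹ * min x y ≤ x⁻¹ * x := by
          gcongr
          exact min_le_left _ _
      _ = 1 := inv_mul_cancel₀ hx.ne'
      _ ≤ _ := Real.one_le_rpow h hd0

/-- The decay of `bumpHat` expressed at the scale `δ`. -/
lemma norm_bumpHat_mul_le {C : ℝ} (hC : 0 < C) (hb : ∀ ξ, ‖bumpHat ξ‖ ≤ C / (1 + |ξ|) ^ 5) {δ t : ℝ}
    (hδ : 0 < δ) (hδ1 : δ ≤ 1) (ht0 : 0 ≤ t) (ht1 : t ≤ 1) (n : ℝ) :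
    ‖bumpHat (δ * n)‖ ≤ C * δ ^ (-t) * (1 + |n|) ^ (-t) := by
  refine (hb _).trans ?_
  rw [mul_assoc, ← Real.mul_rpow hδ.le (by positivity), div_eq_mul_inv, abs_mul, abs_of_pos hδ]
  gcongr
  have h1 : δ * (1 + |n|) ≤ 1 + δ * |n| := by linarith
  have h2 : (1 : ℝ) ≤ 1 + δ * |n| := by linarith [mul_nonneg hδ.le (abs_nonneg n)]
  calc ((1 + δ * |n|) ^ 5)⁻¹ = (1 + δ * |n|) ^ (-5 : ℝ) := by
        rw [Real.rpow_neg (by positivity)]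
        norm_cast
    _ ≤ (1 + δ * |n|) ^ (-t) := Real.rpow_le_rpow_of_exponent_le h2 (by linarith)
    _ ≤ _ := Real.rpow_le_rpow_of_nonpos (by positivity) h1 (by linarith)

lemma inv_le_abs_div_sub_div {q q' : ℕ} (hq : 0 < q) (hq' : 0 < q') {r r' : ℤ}
    (hne : r * q' ≠ r' * q) : ((q : ℝ) * q')⁻¹ ≤ |(r : ℝ) / q - r' / q'| := by
  have h1 : (0 : ℝ) < q := by exact_mod_cast hq
  have h2 : (0 : ℝ) < q' := by exact_mod_cast hq'
  rw [div_sub_div _ _ h1.ne' h2.ne', abs_div, abs_of_pos (mul_pos h1 h2), inv_eq_one_div]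
  gcongr
  have : (1 : ℤ) ≤ |r * q' - q * r'| := Int.one_le_abs (by rwa [mul_comm (q : ℤ), sub_ne_zero])
  exact_mod_cast this

/-- Two fractions with distinct prime denominators can only agree if `q` divides `r`, which `0 < r <
q` forbids. Unequal fractions differ by at least `1/(q q')`. -/
lemma separated_of_prime {P : Finset ℕ} {B : ℝ} (hP : ∀ q ∈ P, q.Prime)
    (hB : ∀ q ∈ P, (q : ℝ) ≤ B) :
    ∀ q ∈ P, ∀ q' ∈ P, ∀ r r' : ℤ, 0 < r → r < q → 0 < r' → r' < q' → (q, r) ≠ (q', r') →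
      (B ^ 2)⁻¹ ≤ |(r : ℝ) / q - r' / q'| := by
  intro q hq q' hq' r r' hr hrq hr' hrq' hne
  have h1 : (0 : ℝ) < q := by exact_mod_cast (hP q hq).pos
  have h2 : (0 : ℝ) < q' := by exact_mod_cast (hP q' hq').pos
  refine le_trans ?_ (inv_le_abs_div_sub_div (hP q hq).pos (hP q' hq').pos ?_)
  · rw [sq]
    gcongr
    · exact h1.le.trans (hB q hq)
    · exact hB q hq
    · exact hB q' hq'
  · intro h
    by_cases hqq : q = q'
    · subst hqq
      have : (q : ℤ) ≠ 0 := by exact_mod_cast (hP q hq).ne_zero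
      exact hne (by rw [mul_right_cancel₀ this h])
    · have hcop : IsCoprime (q : ℤ) (q' : ℤ) :=
        Nat.isCoprime_iff_coprime.2 ((Nat.coprime_primes (hP q hq) (hP q' hq')).2 hqq)
      have hdvd : (q : ℤ) ∣ r := hcop.dvd_of_dvd_mul_right (h ▸ Dvd.intro_left _ rfl)
      exact absurd (Int.le_of_dvd hr hdvd) (by omega)

set_option maxHeartbeats 800000 in
/-- Combs over primes: they are supported near rationals, their Fourier coefficients decay at the
optimal rate, and their interval masses are as regular as possible. -/
lemma exists_primeComb {α ε γ : ℝ} (hα : 0 < α) (hε : 0 < ε) (hγ : 0 < γ) (hγ1 : γ ≤ 1) :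
    ∃ A : ℝ, 0 < A ∧ ∀ X : ℝ, ∃ (L : ℝ) (P : Finset ℕ) (δ : ℝ), X ≤ L ∧ 1 ≤ L ∧ 0 < δ ∧
      P.Nonempty ∧
      (∀ q ∈ P, 0 < q ∧ X ≤ q ∧ q * δ ≤ 1 / 4 ∧ 2 * δ ≤ (q : ℝ) ^ (-(2 + α))) ∧
      (∀ n : ℤ, n ≠ 0 →
        ‖combCoeff P δ n‖ ≤ A * L⁻¹ * (1 + |(n : ℝ)|) ^ (-(1 / (2 + α) - ε))) ∧
      (∀ c r : ℝ, 0 < r → r ≤ 1 / 4 →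
        ∫ y in Icc (c - r) (c + r) ∩ baseInterval, comb P δ y ≤ A * L ^ γ * r ^ (2 / (2 + α))) := by
  obtain ⟨C, hC, hb⟩ := exists_norm_bumpHat_le
  have hm := bumpMass_pos
  have hlog : 0 < Real.log 2 := Real.log_pos one_lt_two
  set d := 2 / (2 + α) with hd
  set s := 1 / (2 + α) with hs
  have hd0 : 0 ≤ d := by positivity
  have hd1 : d ≤ 1 := by rw [hd, div_le_one (by linarith)]; linarith
  have hs0 : 0 ≤ s := by positivity
  have hs1 : s ≤ 1 := by rw [hs, div_le_one (by linarith)]; linarith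
  -- The budget `ε` is spent in thirds: `Z^κ` for the number of prime divisors of `n`, and `Z^(2κ)`
  -- to absorb `L^γ · L ≤ L² = Q^(2κ)`.
  set κ := ε / 3 with hκ
  have hκ0 : 0 < κ := by positivity
  set A₁ := 16 * C / (κ * Real.log 2 * bumpMass) with hA₁
  set A₂ := 64 * (2 / bumpMass) ^ d + 8 with hA₂
  have hA₁0 : 0 < A₁ := by positivity
  have hA₂0 : 0 < A₂ := by positivity
  refine ⟨A₁ + A₂, by positivity, fun X => ?_⟩
  obtain ⟨Q, hXQ, hQ1, hcard⟩ := exists_many_primes (mul_pos hκ0 hγ) (⌈(max X 1) ^ κ⁻¹⌉₊ + ⌈X⌉₊)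
  set P := (Finset.Ioc Q (2 * Q)).filter Nat.Prime with hP
  have hQ1' : (1 : ℝ) ≤ Q := by exact_mod_cast hQ1
  have hQ0 : (0 : ℝ) < Q := by linarith
  have hXQ' : (max X 1) ^ κ⁻¹ ≤ Q :=
    (Nat.le_ceil _).trans (by exact_mod_cast (Nat.le_add_right _ _).trans hXQ)
  have hXQ'' : X ≤ Q := (Nat.le_ceil _).trans (by exact_mod_cast (Nat.le_add_left _ _).trans hXQ)
  set L := (Q : ℝ) ^ κ with hL
  have hXL : max X 1 ≤ L := by
    have := Real.rpow_le_rpow (by positivity) hXQ' hκ0.le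
    rwa [← Real.rpow_mul (by positivity), inv_mul_cancel₀ hκ0.ne', Real.rpow_one] at this
  have hL1 : 1 ≤ L := (le_max_right _ _).trans hXL
  have hL0 : 0 < L := by linarith
  have hLγ : L ^ γ = (Q : ℝ) ^ (κ * γ) := by rw [hL, ← Real.rpow_mul hQ0.le]
  have hPprime : ∀ q ∈ P, q.Prime := fun q hq => (Finset.mem_filter.1 hq).2
  have hPlow : ∀ q ∈ P, (Q : ℝ) ≤ q := fun q hq => by
    exact_mod_cast (Finset.mem_Ioc.1 (Finset.mem_filter.1 hq).1).1.le
  have hPup : ∀ q ∈ P, (q : ℝ) ≤ 2 * Q := fun q hq => by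
    exact_mod_cast (Finset.mem_Ioc.1 (Finset.mem_filter.1 hq).1).2
  have hPcard : (0 : ℝ) < P.card := lt_of_lt_of_le (by positivity) hcard
  have hPinv : (P.card : ℝ)⁻¹ ≤ (Q : ℝ)⁻¹ * L ^ γ := by
    rw [hLγ, ← Real.rpow_neg_one (Q : ℝ), ← Real.rpow_add hQ0, inv_le_comm₀ hPcard (by positivity),
      ← Real.rpow_neg hQ0.le]
    convert! hcard using 2
    ring
  -- The width is adapted to the largest possible denominator `2Q`, so that `2δ ≤ q^(-(2+α))` holds
  -- for every `q ∈ P`.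
  set δ := 1 / 8 * (2 * (Q : ℝ)) ^ (-(2 + α)) with hδ
  have hδ0 : 0 < δ := by positivity
  have hQ2 : (2 * (Q : ℝ)) ^ (-(2 + α)) ≤ ((2 * (Q : ℝ)) ^ 2)⁻¹ := by
    rw [← Real.rpow_natCast, ← Real.rpow_neg (by positivity)]
    exact Real.rpow_le_rpow_of_exponent_le (by linarith) (by push_cast; linarith)
  have hδQ : δ ≤ 1 / (32 * (Q : ℝ) ^ 2) := by
    rw [hδ]
    calc 1 / 8 * (2 * (Q : ℝ)) ^ (-(2 + α)) ≤ 1 / 8 * ((2 * (Q : ℝ)) ^ 2)⁻¹ := by gcongr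
      _ = _ := by field_simp; norm_num
  have hδ32 : δ ≤ 1 / 32 := by
    refine hδQ.trans ?_
    gcongr
    nlinarith
  have hδpow : ∀ t : ℝ, 0 ≤ t → t ≤ 1 → δ ^ (-t) ≤ 8 * (2 * (Q : ℝ)) ^ ((2 + α) * t) := by
    intro t ht0 ht1
    rw [hδ, Real.mul_rpow (by norm_num) (by positivity), ← Real.rpow_mul (by positivity)]
    have e1 : ((1 / 8 : ℝ)) ^ (-t) ≤ 8 := by
      rw [one_div, Real.inv_rpow (by norm_num), Real.rpow_neg (by norm_num), inv_inv]
      simpa using Real.rpow_le_rpow_of_exponent_le (by norm_num : (1 : ℝ) ≤ 8) ht1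
    rw [neg_mul_neg]
    gcongr
  refine ⟨L, P, δ, (le_max_left _ _).trans hXL, hL1, hδ0,
    Finset.card_pos.1 (by exact_mod_cast hPcard), fun q hq => ?_, fun n hn => ?_,
    fun c r hr hr4 => ?_⟩
  · refine ⟨(hPprime q hq).pos, hXQ''.trans (hPlow q hq), ?_, ?_⟩
    · calc (q : ℝ) * δ ≤ 2 * Q * (1 / (32 * (Q : ℝ) ^ 2)) := by
            gcongr
            exact hPup q hq
        _ = 1 / 16 * (Q : ℝ)⁻¹ := by field_simp; norm_num
        _ ≤ 1 / 16 * 1 := by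
            gcongr
            exact inv_le_one_of_one_le₀ hQ1'
        _ ≤ 1 / 4 := by norm_num
    · have h1 : (0 : ℝ) < q := by exact_mod_cast (hPprime q hq).pos
      calc 2 * δ = 1 / 4 * (2 * (Q : ℝ)) ^ (-(2 + α)) := by rw [hδ]; ring
        _ ≤ 1 * (2 * (Q : ℝ)) ^ (-(2 + α)) := by gcongr; norm_num
        _ ≤ (q : ℝ) ^ (-(2 + α)) := by
            rw [one_mul]
            exact Real.rpow_le_rpow_of_nonpos h1 (hPup q hq) (by linarith)
  · refine (norm_combCoeff_le P δ n).trans ?_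
    set k := (P.filter fun q : ℕ => (q : ℤ) ∣ n).card with hk
    set Z := 1 + |(n : ℝ)| with hZ
    have hZ1 : 1 ≤ Z := by linarith [abs_nonneg (n : ℝ)]
    have hZ0 : 0 < Z := by linarith
    -- The coefficient vanishes unless some `q ∈ P` divides `n`; then `|n| ≥ Q`, which allows powers
    -- of `Q` to be traded for powers of `1 + |n|`.
    rcases Nat.eq_zero_or_pos k with hk0 | hk0
    · rw [hk0]
      simp only [Nat.cast_zero, mul_zero, zero_mul]
      positivity
    · obtain ⟨q, hq⟩ := Finset.card_pos.1 hk0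
      rw [Finset.mem_filter] at hq
      have hQZ : (Q : ℝ) ≤ Z := by
        have h1 : (q : ℤ) ≤ |n| := Int.le_of_dvd (abs_pos.2 hn) ((dvd_abs _ _).2 hq.2)
        have h2 : (q : ℝ) ≤ |(n : ℝ)| := by exact_mod_cast h1
        linarith [hPlow q hq.1]
      have hkle : (k : ℝ) ≤ Z ^ κ / (κ * Real.log 2) := by
        refine (card_prime_dvd_le hPprime hn hκ0).trans ?_
        gcongr
        linarith
      -- For `s = 1/(2+α)` the loss `δ^(-s)` is about `Q`, exactly compensated by `P.card⁻¹ ≤ Q⁻¹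
      -- L^γ`.
      have hbh : ‖bumpHat (δ * n)‖ ≤ C * (16 * Q) * Z ^ (-s) := by
        refine (norm_bumpHat_mul_le hC hb hδ0 (by linarith) hs0 hs1 n).trans ?_
        gcongr
        refine (hδpow s hs0 hs1).trans_eq ?_
        rw [hs, mul_one_div_cancel (by linarith), Real.rpow_one]
        ring
      have hLZ : L ^ γ * L ≤ Z ^ (2 * κ) := by
        calc L ^ γ * L ≤ L ^ (1 : ℝ) * L := by gcongr
          _ = (Q : ℝ) ^ (2 * κ) := by
            rw [Real.rpow_one, hL, ← Real.rpow_add hQ0]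
            ring_nf
          _ ≤ _ := by gcongr
      calc (P.card : ℝ)⁻¹ * k * (‖bumpHat (δ * n)‖ / bumpMass)
          ≤ ((Q : ℝ)⁻¹ * L ^ γ) * (Z ^ κ / (κ * Real.log 2)) *
              (C * (16 * Q) * Z ^ (-s) / bumpMass) := by gcongr
        _ = A₁ * L⁻¹ * ((L ^ γ * L) * (Z ^ κ * Z ^ (-s))) := by
            rw [hA₁]
            field_simp
        _ ≤ A₁ * L⁻¹ * (Z ^ (2 * κ) * (Z ^ κ * Z ^ (-s))) := by gcongr
        _ = A₁ * L⁻¹ * Z ^ (-(s - ε)) := by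
            rw [← Real.rpow_add hZ0, ← Real.rpow_add hZ0]
            congr 2
            rw [hκ]
            ring
        _ ≤ _ := by
            gcongr
            linarith
  · have h1 := setIntegral_comb_le hδ0 hδ32 hQ0 hPlow (d := ((2 * (Q : ℝ)) ^ 2)⁻¹) (by positivity)
      (separated_of_prime hPprime hPup) c hr
    refine h1.trans ?_
    set μ := (δ * bumpMass)⁻¹ * min (δ * bumpMass) (2 * r) with hμ
    have hμ0 : 0 ≤ μ := by positivity
    have hμ1 : μ ≤ 1 := by
      calc μ ≤ (δ * bumpMass)⁻¹ * (δ * bumpMass) := by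
            rw [hμ]
            gcongr
            exact min_le_left _ _
        _ = 1 := inv_mul_cancel₀ (by positivity)
    -- Here `δ^(-d)` is about `Q²`, matching the mass `Q⁻²` of one bump up to `L^γ`. This handles
    -- the boundedly many bumps that meet even a tiny interval; for the remaining ones `μ ≤ 1` gives
    -- a bound linear in `r`.
    have hμ2 : μ ≤ 32 * (Q : ℝ) ^ 2 * ((2 / bumpMass) ^ d * r ^ d) := by
      refine (min_one_div_le_rpow hd0 hd1 (by positivity) (by positivity)).trans ?_
      rw [show 2 * r / (δ * bumpMass) = δ⁻¹ * (2 / bumpMass * r) by field_simp,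
        Real.mul_rpow (by positivity) (by positivity), Real.mul_rpow (by positivity) hr.le,
        Real.inv_rpow hδ0.le, ← Real.rpow_neg hδ0.le]
      gcongr
      refine (hδpow d hd0 hd1).trans_eq ?_
      rw [hd, mul_div_cancel₀ _ (by linarith), Real.rpow_two]
      ring
    have hsum : 1 + (2 * r + 4 * δ) / ((2 * (Q : ℝ)) ^ 2)⁻¹ ≤ 2 + 8 * (Q : ℝ) ^ 2 * r := by
      rw [div_inv_eq_mul]
      have : δ * (Q : ℝ) ^ 2 ≤ 1 / 32 := by
        rw [le_div_iff₀ (by positivity)] at hδQ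
        linarith
      calc 1 + (2 * r + 4 * δ) * (2 * (Q : ℝ)) ^ 2
          = 1 + 8 * (Q : ℝ) ^ 2 * r + 16 * (δ * (Q : ℝ) ^ 2) := by ring
        _ ≤ _ := by linarith
    have hrd : r ≤ r ^ d := by
      simpa using Real.rpow_le_rpow_of_exponent_ge hr (by linarith) hd1
    calc (1 + (2 * r + 4 * δ) / ((2 * (Q : ℝ)) ^ 2)⁻¹) *
          ((P.card : ℝ)⁻¹ * ((Q * δ * bumpMass)⁻¹ * min (δ * bumpMass) (2 * r)))
        = (1 + (2 * r + 4 * δ) / ((2 * (Q : ℝ)) ^ 2)⁻¹) * ((P.card : ℝ)⁻¹ * ((Q : ℝ)⁻¹ * μ)) := by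
          rw [hμ, mul_assoc (Q : ℝ), mul_inv (Q : ℝ)]
          ring
      _ ≤ (2 + 8 * (Q : ℝ) ^ 2 * r) * (((Q : ℝ)⁻¹ * L ^ γ) * ((Q : ℝ)⁻¹ * μ)) := by gcongr
      _ = L ^ γ * (2 * ((Q : ℝ) ^ 2)⁻¹ * μ + 8 * r * μ) := by field_simp
      _ ≤ L ^ γ * (2 * ((Q : ℝ) ^ 2)⁻¹ * (32 * (Q : ℝ) ^ 2 * ((2 / bumpMass) ^ d * r ^ d)) +
            8 * r ^ d * 1) := by gcongr
      _ = A₂ * L ^ γ * r ^ d := by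
          rw [hA₂]
          field_simp
          ring
      _ ≤ _ := by
          gcongr
          linarith

set_option maxHeartbeats 800000 in
/-- Combs over a single arithmetic progression of about `Q ^ (1 + β)` points at the scale
`Q ^ (-(2 + α))`, carrying the mass `Q ^ (-(1 - β))`: this is the largest mass that is
compatible with the required Fourier decay and regularity. -/
lemma exists_arithComb {α β ε : ℝ} (hα : 0 < α) (hβ0 : 0 ≤ β) (hβ1 : β < 1) (hε : 0 < ε) :
    ∃ A : ℝ, 0 < A ∧ ∀ X : ℝ, ∃ (L Q : ℝ) (N : ℕ) (δ M : ℝ), X ≤ L ∧ 1 ≤ L ∧ X ≤ Q ∧ 1 ≤ Q ∧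
      Q ≤ N ∧ (N : ℝ) ≤ 2 * Q ^ (1 + β) ∧ δ = Q ^ (-(2 + α)) ∧ M = Q ^ (-(1 - β)) ∧ M ≤ 1 ∧
      N * δ ≤ 1 / 8 ∧
      (∀ n : ℤ, n ≠ 0 → ‖M * combCoeff {N} δ n‖ ≤
        A * L⁻¹ * (1 + |(n : ℝ)|) ^ (-((1 - β) / (2 + α) - ε))) ∧
      (∀ n : ℤ, n ≠ 0 → ‖combCoeff {N} δ n‖ ≤ A * Q⁻¹ * (1 + |(n : ℝ)|)) ∧
      (∀ c r : ℝ, 0 < r → r ≤ 1 / 4 →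
        ∫ y in Icc (c - r) (c + r) ∩ baseInterval, ((1 - M) + M * comb {N} δ y) ≤
          A * r ^ (2 / (2 + α))) := by
  obtain ⟨C, hC, hb⟩ := exists_norm_bumpHat_le
  have hm := bumpMass_pos
  set d := 2 / (2 + α) with hd
  set s := (1 - β) / (2 + α) with hs
  have hd0 : 0 ≤ d := by positivity
  have hd1 : d ≤ 1 := by rw [hd, div_le_one (by linarith)]; linarith
  have hs0 : 0 ≤ s := div_nonneg (by linarith) (by linarith)
  have hs1 : s ≤ 1 := by rw [hs, div_le_one (by linarith)]; linarith
  set A₁ := C / bumpMass with hA₁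
  set A₂ := 2 * (2 / bumpMass) ^ d + 4 with hA₂
  have hA₁0 : 0 < A₁ := by positivity
  have hA₂0 : 0 < A₂ := by positivity
  refine ⟨A₁ + A₂, by positivity, fun X => ?_⟩
  -- `Q ≥ 32` gives `δ ≤ 1/32`, and `Q^α ≥ 16` gives `N δ ≤ 2 Q^(-α) ≤ 1/8`.
  obtain ⟨Q, hQ32, hXQ, hXL, hQα⟩ := ((Filter.eventually_ge_atTop (32 : ℝ)).and
    ((Filter.eventually_ge_atTop X).and
    (((tendsto_rpow_atTop hε).eventually_ge_atTop X).and
    ((tendsto_rpow_atTop hα).eventually_ge_atTop 16)))).exists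
  have hQ0 : 0 < Q := by linarith
  have hQ1 : 1 ≤ Q := by linarith
  set L := Q ^ ε with hL
  have hL1 : 1 ≤ L := Real.one_le_rpow hQ1 hε.le
  have hL0 : 0 < L := by linarith
  set N := ⌈Q ^ (1 + β)⌉₊ with hN
  have hQβ : Q ≤ Q ^ (1 + β) := by
    simpa using Real.rpow_le_rpow_of_exponent_le hQ1 (by linarith : (1 : ℝ) ≤ 1 + β)
  have hNlow : Q ^ (1 + β) ≤ N := Nat.le_ceil _
  have hNup : (N : ℝ) ≤ 2 * Q ^ (1 + β) := by
    have := (Nat.ceil_lt_add_one (by positivity : 0 ≤ Q ^ (1 + β))).le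
    linarith
  have hN0 : (0 : ℝ) < N := by linarith
  have hNpos : 0 < N := by exact_mod_cast hN0
  set δ := Q ^ (-(2 + α)) with hδ
  have hδ0 : 0 < δ := by positivity
  set M := Q ^ (-(1 - β)) with hM
  have hM0 : 0 < M := by positivity
  have hM1 : M ≤ 1 := Real.rpow_le_one_of_one_le_of_nonpos hQ1 (by linarith)
  have hQα' : Q ^ (-α) ≤ 1 / 16 := by
    rw [Real.rpow_neg hQ0.le, one_div]
    exact inv_anti₀ (by norm_num) hQα
  have hNδ : N * δ ≤ 1 / 8 := by
    calc N * δ ≤ 2 * Q ^ (1 + β) * δ := by gcongr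
      _ = 2 * Q ^ (-α) * M := by
        rw [hδ, hM, mul_assoc, mul_assoc, ← Real.rpow_add hQ0, ← Real.rpow_add hQ0]
        ring_nf
      _ ≤ 2 * (1 / 16) * 1 := by gcongr
      _ = 1 / 8 := by norm_num
  have hδ32 : δ ≤ 1 / 32 := by
    calc δ ≤ Q ^ (-1 : ℝ) := Real.rpow_le_rpow_of_exponent_le hQ1 (by linarith)
      _ ≤ 1 / 32 := by
        rw [Real.rpow_neg_one, one_div]
        exact inv_anti₀ (by norm_num) hQ32
  have hδpow : ∀ t : ℝ, δ ^ (-t) = Q ^ ((2 + α) * t) := by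
    intro t
    rw [hδ, ← Real.rpow_mul hQ0.le, neg_mul_neg]
  have hcoef : ∀ n : ℤ, ‖combCoeff {N} δ n‖ ≤ ‖bumpHat (δ * n)‖ / bumpMass := by
    intro n
    refine (norm_combCoeff_le _ _ _).trans ?_
    have h1 : ((Finset.filter (fun q : ℕ => (q : ℤ) ∣ n) {N}).card : ℝ) ≤ 1 := by
      exact_mod_cast (Finset.card_filter_le _ _).trans_eq (Finset.card_singleton _)
    rw [Finset.card_singleton, Nat.cast_one, inv_one, one_mul]
    exact mul_le_of_le_one_left (by positivity) h1
  -- The vanishing at low frequencies yields both coefficient bounds: it turns `L = Q^ε` into `(1 +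
  -- |n|)^ε`, and it makes `Q⁻¹ (1 + |n|)` a valid, though growing, bound for the comb without the
  -- factor `M`.
  have hcoef0 : ∀ n : ℤ, n ≠ 0 → ¬ Q ≤ 1 + |(n : ℝ)| → combCoeff {N} δ n = 0 := by
    intro n hn hlt
    rw [combCoeff, Finset.sum_singleton, if_neg, mul_zero]
    intro hdvd
    apply hlt
    have h1 : (N : ℤ) ≤ |n| := Int.le_of_dvd (abs_pos.2 hn) ((dvd_abs _ _).2 hdvd)
    have h2 : (N : ℝ) ≤ |(n : ℝ)| := by exact_mod_cast h1
    linarith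
  refine ⟨L, Q, N, δ, M, hXL, hL1, hXQ, hQ1, hQβ.trans hNlow, hNup, rfl, rfl, hM1, hNδ,
    fun n hn => ?_, fun n hn => ?_, fun c r hr hr4 => ?_⟩
  · set Z := 1 + |(n : ℝ)| with hZ
    have hZ0 : 0 < Z := by positivity
    by_cases hQZ : Q ≤ Z
    · have hLZ : L ≤ Z ^ ε := Real.rpow_le_rpow hQ0.le hQZ hε.le
      have hbh : ‖bumpHat (δ * n)‖ ≤ C * Q ^ (1 - β) * Z ^ (-s) := by
        refine (norm_bumpHat_mul_le hC hb hδ0 (by linarith) hs0 hs1 n).trans_eq ?_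
        rw [hδpow, hs, mul_div_cancel₀ _ (by linarith)]
      rw [norm_mul, Complex.norm_real, Real.norm_of_nonneg hM0.le]
      calc M * ‖combCoeff {N} δ n‖ ≤ M * (C * Q ^ (1 - β) * Z ^ (-s) / bumpMass) := by
            gcongr
            exact (hcoef n).trans (by gcongr)
        _ = (Q ^ (-(1 - β)) * Q ^ (1 - β)) * A₁ * L⁻¹ * (L * Z ^ (-s)) := by
            rw [hA₁, hM]
            field_simp
        _ = A₁ * L⁻¹ * (L * Z ^ (-s)) := by
            rw [← Real.rpow_add hQ0, neg_add_cancel, Real.rpow_zero, one_mul]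
        _ ≤ (A₁ + A₂) * L⁻¹ * (Z ^ ε * Z ^ (-s)) := by
            gcongr
            linarith
        _ = _ := by
            rw [← Real.rpow_add hZ0]
            ring_nf
    · rw [hcoef0 n hn hQZ, mul_zero, norm_zero]
      positivity
  · by_cases hQZ : Q ≤ 1 + |(n : ℝ)|
    · have h1 : 1 ≤ Q⁻¹ * (1 + |(n : ℝ)|) := by
        rw [inv_mul_eq_div]
        exact (one_le_div hQ0).2 hQZ
      have h2 : ‖bumpHat (δ * n)‖ ≤ C := (hb _).trans (div_le_self hC.le
        (one_le_pow₀ (by linarith [abs_nonneg (δ * n)])))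
      calc ‖combCoeff {N} δ n‖ ≤ A₁ * 1 := by
            rw [mul_one]
            exact (hcoef n).trans (by rw [hA₁]; gcongr)
        _ ≤ (A₁ + A₂) * (Q⁻¹ * (1 + |(n : ℝ)|)) := by
            gcongr
            linarith
        _ = _ := by ring
    · rw [hcoef0 n hn hQZ, norm_zero]
      positivity
  · have hsep : ∀ q ∈ ({N} : Finset ℕ), ∀ q' ∈ ({N} : Finset ℕ), ∀ r r' : ℤ, 0 < r → r < q →
        0 < r' → r' < q' → (q, r) ≠ (q', r') → (N : ℝ)⁻¹ ≤ |(r : ℝ) / q - r' / q'| := by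
      intro q hq q' hq' r r' _ _ _ _ hne
      rw [Finset.mem_singleton] at hq hq'
      subst hq
      rw [hq', ← sub_div, abs_div, abs_of_pos hN0, inv_eq_one_div]
      gcongr
      have : (1 : ℤ) ≤ |r - r'| := by
        refine Int.one_le_abs (sub_ne_zero.2 fun h => hne ?_)
        rw [hq', h]
      exact_mod_cast this
    have h1 := setIntegral_comb_le hδ0 hδ32 hN0 (P := {N}) (d := (N : ℝ)⁻¹) (by simp)
      (by positivity) hsep c hr
    set I := Icc (c - r) (c + r) ∩ baseInterval with hI
    have hcont : Continuous (comb {N} δ) :=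
      (isTrig_comb hδ0 (by simpa using ⟨hNpos, by linarith⟩)).continuous
    have hint : ∀ f : ℝ → ℝ, Continuous f → IntegrableOn f I := fun f hf =>
      (hf.integrableOn_Icc (a := c - r) (b := c + r)).mono_set inter_subset_left
    have hvol : volume.real I ≤ 2 * r := by
      calc volume.real I ≤ volume.real (Icc (c - r) (c + r)) :=
            measureReal_mono inter_subset_left isCompact_Icc.measure_ne_top
        _ = 2 * r := by
            rw [Real.volume_real_Icc_of_le (by linarith)]
            ring
    rw [integral_add (f := fun _ => 1 - M) (g := fun y => M * comb {N} δ y)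
      (hint _ continuous_const) (hint _ (continuous_const.mul hcont)),
      integral_const_mul, setIntegral_const, smul_eq_mul]
    set μ := (δ * bumpMass)⁻¹ * min (δ * bumpMass) (2 * r) with hμ
    have hμ0 : 0 ≤ μ := by positivity
    have hμ1 : μ ≤ 1 := by
      calc μ ≤ (δ * bumpMass)⁻¹ * (δ * bumpMass) := by
            rw [hμ]
            gcongr
            exact min_le_left _ _
        _ = 1 := inv_mul_cancel₀ (by positivity)
    have hμ2 : μ ≤ Q ^ 2 * ((2 / bumpMass) ^ d * r ^ d) := by
      refine (min_one_div_le_rpow hd0 hd1 (by positivity) (by positivity)).trans_eq ?_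
      rw [show 2 * r / (δ * bumpMass) = δ⁻¹ * (2 / bumpMass * r) by field_simp,
        Real.mul_rpow (by positivity) (by positivity), Real.mul_rpow (by positivity) hr.le,
        Real.inv_rpow hδ0.le, ← Real.rpow_neg hδ0.le, hδpow, hd, mul_div_cancel₀ _ (by linarith),
        Real.rpow_two]
    have hsum : 1 + (2 * r + 4 * δ) / (N : ℝ)⁻¹ ≤ 2 + 2 * N * r := by
      rw [div_inv_eq_mul]
      linarith
    -- The mass of a single bump: `(1-β) + (1+β) = 2`, which is why `β` disappears from the
    -- regularity exponent.
    have hMN : M * (N : ℝ)⁻¹ ≤ (Q ^ 2)⁻¹ := by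
      calc M * (N : ℝ)⁻¹ ≤ M * (Q ^ (1 + β))⁻¹ := by gcongr
        _ = (Q ^ 2)⁻¹ := by
          rw [hM, ← Real.rpow_neg hQ0.le, ← Real.rpow_add hQ0, ← Real.rpow_natCast,
            ← Real.rpow_neg hQ0.le]
          congr 1
          push_cast
          ring
    have hrd : r ≤ r ^ d := by
      simpa using Real.rpow_le_rpow_of_exponent_ge hr (by linarith) hd1
    have h2 : M * ∫ y in I, comb {N} δ y ≤ 2 * (2 / bumpMass) ^ d * r ^ d + 2 * r := by
      calc M * ∫ y in I, comb {N} δ y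
          ≤ M * ((1 + (2 * r + 4 * δ) / (N : ℝ)⁻¹) * ((({N} : Finset ℕ).card : ℝ)⁻¹ *
              ((N * δ * bumpMass)⁻¹ * min (δ * bumpMass) (2 * r)))) := by gcongr
        _ = M * ((1 + (2 * r + 4 * δ) / (N : ℝ)⁻¹) * ((N : ℝ)⁻¹ * μ)) := by
            rw [hμ, mul_assoc (N : ℝ), mul_inv (N : ℝ), Finset.card_singleton]
            push_cast
            ring
        _ ≤ M * ((2 + 2 * N * r) * ((N : ℝ)⁻¹ * μ)) := by gcongr
        _ = 2 * (M * (N : ℝ)⁻¹) * μ + 2 * M * r * μ := by field_simp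
        _ ≤ 2 * (Q ^ 2)⁻¹ * (Q ^ 2 * ((2 / bumpMass) ^ d * r ^ d)) + 2 * 1 * r * 1 := by gcongr
        _ = _ := by field_simp
    have h3 : volume.real I * (1 - M) ≤ 2 * r * 1 := by
      gcongr
      linarith
    calc volume.real I * (1 - M) + M * ∫ y in I, comb {N} δ y
        ≤ 2 * (2 / bumpMass) ^ d * r ^ d + 4 * r := by linarith
      _ ≤ 2 * (2 / bumpMass) ^ d * r ^ d + 4 * r ^ d := by gcongr
      _ = A₂ * r ^ d := by rw [hA₂]; ring
      _ ≤ _ := by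
        gcongr
        linarith

/-! ### One step of the construction -/

lemma abs_real_univ_sub_le {σ σ' : Measure ℝ} {θ : ℝ}
    (h : ‖fourierMeasure σ 0 - fourierMeasure σ' 0‖ ≤ θ) :
    |σ.real univ - σ'.real univ| ≤ θ := by
  rwa [fourierMeasure_zero, fourierMeasure_zero, ← Complex.ofReal_sub, Complex.norm_real,
    Real.norm_eq_abs] at h

lemma IsDens.real_univ {g : ℝ → ℝ} (hg : IsDens g) : (densMeasure g).real univ = ∫ x, g x := by
  have := hg.integral_eq (fun _ => (1 : ℝ))
  simpa using this

lemma continuous_abs_sub_round : Continuous fun y : ℝ => |y - round y| := by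
  have : (fun y : ℝ => |y - round y|) = fun y : ℝ => ‖(y : UnitAddCircle)‖ :=
    funext fun y => UnitAddCircle.norm_eq.symm
  rw [this]
  exact continuous_norm.comp (AddCircle.continuous_mk' 1)

/-- The points within `w / N` of the progression `N⁻¹ ℤ`. -/
def nearProgression (N : ℕ) (w : ℝ) : Set ℝ := {x | |(N : ℝ) * x - round ((N : ℝ) * x)| ≤ w}

lemma isClosed_nearProgression (N : ℕ) (w : ℝ) : IsClosed (nearProgression N w) :=
  isClosed_le (continuous_abs_sub_round.comp (by fun_prop)) continuous_const

/-- The points lying within the prescribed distance of a rational of denominator at least `k`. -/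
def approxBy (α : ℝ) (k : ℕ) : Set ℝ :=
  {x | ∃ (q : ℕ) (r : ℤ), 0 < q ∧ k ≤ q ∧ |x - r / q| ≤ (q : ℝ) ^ (-(2 + α))}

lemma nearProgression_subset_approxBy {α δ : ℝ} {k q : ℕ} (hq : 0 < q) (hk : k ≤ q)
    (hδ : 2 * δ ≤ (q : ℝ) ^ (-(2 + α))) : nearProgression q (2 * (q * δ)) ⊆ approxBy α k := by
  intro x hx
  have hq' : (0 : ℝ) < q := by exact_mod_cast hq
  refine ⟨q, round ((q : ℝ) * x), hq, hk, le_trans ?_ hδ⟩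
  rw [show x - round ((q : ℝ) * x) / q = ((q : ℝ) * x - round ((q : ℝ) * x)) / q by field_simp,
    abs_div, abs_of_pos hq', div_le_iff₀ hq']
  refine le_trans hx (le_of_eq ?_)
  ring

lemma exists_mem_nearProgression_of_comb_ne_zero {P : Finset ℕ} {δ x : ℝ} (hδ : 0 < δ)
    (hP : ∀ q ∈ P, 0 < q) (h : comb P δ x ≠ 0) :
    ∃ q ∈ P, x ∈ nearProgression q (2 * (q * δ)) := by
  obtain ⟨q, hq, hne⟩ := Finset.exists_ne_zero_of_sum_ne_zero (right_ne_zero_of_mul h)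
  have hq' : (0 : ℝ) < q := by exact_mod_cast hP q hq
  exact ⟨q, hq, (lt_of_perBump_ne_zero (by positivity) (right_ne_zero_of_mul hne)).le⟩

/-- If `g'` arises from `g` by superimposing a comb of mass `M` on an arithmetic progression, then
every measure whose Fourier transform is close enough to that of `g'` charges the progression. -/
lemma exists_le_measure_nearProgression {g : ℝ → ℝ} (hg : IsDens g) {N : ℕ} {δ M : ℝ} (hN : 0 < N)
    (hδ : 0 < δ) (hNδ : N * δ ≤ 1 / 8) (hM0 : 0 < M) (hM1 : M ≤ 1)
    (hmass : 3 / 8 ≤ ∫ x, g x * comb {N} δ x) :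
    ∃ θ : ℝ, 0 < θ ∧ ∀ (σ : Measure ℝ), IsFiniteMeasure σ →
      (∀ ξ, ‖fourierMeasure σ ξ -
        fourierMeasure (densMeasure fun x => g x * ((1 - M) + M * comb {N} δ x)) ξ‖ ≤ 2 * θ) →
      1 / 8 * M ≤ σ.real (nearProgression N (4 * (N * δ))) := by
  have hN' : (0 : ℝ) < N := by exact_mod_cast hN
  have hw : 0 < 2 * (N * δ) := by positivity
  -- The test function equals `1` where the comb lives and vanishes beyond `4Nδ`, so its integral is
  -- a smooth lower bound for the mass near the progression.
  obtain ⟨c, ht⟩ : ∃ c, IsTrig (fun x => perBump (2 * (N * δ)) (N * x)) c := by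
    have := (isTrig_perBump hw (by linarith)).dilate (N := (N : ℤ)) (by exact_mod_cast hN.ne')
    simp only [Int.cast_natCast] at this
    exact ⟨_, this⟩
  set S := ∑' n, ‖c n‖ with hS
  have hS0 : 0 ≤ S := tsum_nonneg fun n => norm_nonneg _
  have hcomb : IsTrig (comb {N} δ) (combCoeff {N} δ) :=
    isTrig_comb hδ (by simpa using ⟨hN, by linarith⟩)
  have hc0 := comb_nonneg {N} hδ.le
  have hgc : IsDens fun x => g x * comb {N} δ x := hg.mul hcomb hc0
  have hG0 : ∀ x, 0 ≤ (1 - M) + M * comb {N} δ x := fun x =>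
    add_nonneg (by linarith) (mul_nonneg hM0.le (hc0 x))
  have hg' : IsDens fun x => g x * ((1 - M) + M * comb {N} δ x) :=
    hg.mul ((IsTrig.const (1 - M)).add (hcomb.const_mul M)) hG0
  have := hg'.isFiniteMeasure
  -- The tolerance makes the testing error `2θS` at most `M/4`, leaving `3M/8 - M/4 = M/8`.
  refine ⟨M / (8 * (S + 1)), by positivity, fun σ hσ hclose => ?_⟩
  have h1 := (abs_le.1 (ht.abs_integral_sub_le σ _ hclose)).1
  have h2 : S * (2 * (M / (8 * (S + 1)))) ≤ 1 / 4 * M := by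
    rw [mul_div_assoc', mul_div_assoc', div_le_iff₀ (by positivity)]
    nlinarith
  have h3 : 3 / 8 * M ≤ ∫ x, perBump (2 * (N * δ)) (N * x)
      ∂(densMeasure fun x => g x * ((1 - M) + M * comb {N} δ x)) := by
    rw [hg'.integral_eq]
    calc 3 / 8 * M ≤ M * ∫ x, g x * comb {N} δ x := by
          rw [mul_comm]
          gcongr
      _ = ∫ x, M * (g x * comb {N} δ x) := (integral_const_mul _ _).symm
      _ ≤ _ := by
          refine integral_mono (hgc.integrable.const_mul M) ?_ fun x => ?_
          · exact (hg'.cont.mul ht.continuous).integrable_of_hasCompactSupport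
              hg'.hasCompactSupport.mul_right
          · simp only [smul_eq_mul]
            by_cases h0 : comb {N} δ x = 0
            · rw [h0, mul_zero, mul_zero]
              refine mul_nonneg (mul_nonneg (hg.nonneg x) ?_) (perBump_nonneg _ _)
              linarith
            · obtain ⟨q, hq, hx⟩ :=
                exists_mem_nearProgression_of_comb_ne_zero hδ (by simpa using hN) h0
              rw [Finset.mem_singleton] at hq
              subst hq
              rw [perBump_eq_one hw hx, mul_one]
              have := mul_nonneg (hg.nonneg x) (by linarith : 0 ≤ 1 - M)
              linarith
  have h4 : ∫ x, perBump (2 * (N * δ)) (N * x) ∂σ ≤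
      σ.real (nearProgression N (4 * (N * δ))) := by
    have hmeas := (isClosed_nearProgression N (4 * (N * δ))).measurableSet
    rw [← integral_indicator_one hmeas]
    refine integral_mono_of_nonneg (Filter.Eventually.of_forall fun x => perBump_nonneg _ _)
      ((integrable_const (1 : ℝ)).indicator hmeas) (Filter.Eventually.of_forall fun x => ?_)
    by_cases hx : x ∈ nearProgression N (4 * (N * δ))
    · rw [indicator_of_mem hx]
      exact perBump_le_one _ _
    · rw [indicator_of_notMem hx]
      refine (perBump_eq_zero hw ?_).le
      rw [nearProgression, mem_ofPred_eq, not_le] at hx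
      linarith
  linarith

/-- One step of the construction: a density `g` is replaced by a density `g'` that lives near
rationals of large denominator and charges an arithmetic progression, robustly under perturbations
of size `2 * θ'` in Fourier space. -/
lemma exists_step {α β ε θ : ℝ} (hα : 0 < α) (hβ0 : 0 ≤ β) (hβ1 : β < 1) (hε : 0 < ε)
    (hε1 : ε ≤ 1) (hετ : ε ≤ (1 - β) / (2 + α)) (hθ : 0 < θ) (k : ℕ) {g : ℝ → ℝ} (hg : IsDens g)
    (hmass : 1 / 2 + 2 * θ ≤ (densMeasure g).real univ) :
    ∃ (g' : ℝ → ℝ) (θ' : ℝ), IsDens g' ∧ 0 < θ' ∧ θ' ≤ θ / 2 ∧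
      1 / 2 + 2 * θ' ≤ (densMeasure g').real univ ∧
      (∀ x, g x = 0 → g' x = 0) ∧
      (∀ ξ, ‖fourierMeasure (densMeasure g') ξ - fourierMeasure (densMeasure g) ξ‖ ≤
        θ * (1 + |ξ|) ^ (-((1 - β) / (2 + α) - ε))) ∧
      (∀ x ∈ baseInterval, ∀ r : ℝ, 0 < r → r ≤ 1 / 8 →
        bumpMean (densMeasure g') x r ≤
          bumpMean (densMeasure g) x r + θ * r ^ (2 / (2 + α) - ε)) ∧
      (∃ K, IsClosed K ∧ K ⊆ approxBy α k ∧ ∀ x ∉ K, g' x = 0) ∧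
      ∃ (Q : ℝ) (N : ℕ), k ≤ Q ∧ 1 ≤ Q ∧ 0 < N ∧ (N : ℝ) ≤ 2 * Q ^ (1 + β) ∧
        ∀ σ : Measure ℝ, IsFiniteMeasure σ →
          (∀ ξ, ‖fourierMeasure σ ξ - fourierMeasure (densMeasure g') ξ‖ ≤ 2 * θ') →
          1 / 8 * Q ^ (-(1 - β)) ≤ σ.real (nearProgression N (4 * (N * Q ^ (-(2 + α))))) := by
  set d := 2 / (2 + α) with hd
  set s := (1 - β) / (2 + α) - ε with hs
  have hd1 : d ≤ 1 := by rw [hd, div_le_one (by linarith)]; linarith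
  have hs0 : 0 ≤ s := by linarith
  have hsτ : (1 - β) / (2 + α) ≤ 1 / (2 + α) := by gcongr; linarith
  have hs1 : s ≤ 1 := by
    have : 1 / (2 + α) ≤ 1 := by rw [div_le_one (by linarith)]; linarith
    linarith
  obtain ⟨A, hA, hprime⟩ := exists_primeComb hα hε (γ := ε / 20) (by positivity) (by linarith)
  obtain ⟨A', hA', harith⟩ := exists_arithComb hα hβ0 hβ1 hε
  -- Each of the two multiplications costs at most `θ/8` of the mass. What is left exceeds `1/2 +
  -- θ`, enough for the next tolerance `θ' ≤ θ/2`.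
  obtain ⟨L₀, hL₀, hamp⟩ := hg.exists_amplify (d := d) (s := s) (ε := ε) (γ := ε / 20)
    (θ := θ / 8) hA hd1 hs0 hs1 hε (by positivity) (by linarith) (by positivity)
  obtain ⟨L, P, δ, hXL, hL1, hδ, hPne, hPq, hcoef, hint⟩ := hprime (max L₀ k)
  have hF := isTrig_comb hδ fun q hq => ⟨(hPq q hq).1, (hPq q hq).2.2.1⟩
  obtain ⟨hg₁, hdiff₁, hmean₁⟩ := hamp L ((le_max_left _ _).trans hXL) (comb P δ) (combCoeff P δ) hF
    (comb_nonneg P hδ.le) (combCoeff_zero hPne δ) (fun n hn => (hcoef n hn).trans (by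
      gcongr
      · linarith [abs_nonneg (n : ℝ)]
      · linarith)) (fun x _ r hr hr4 => hint x r hr hr4)
  set g₁ := fun x => g x * comb P δ x with hg₁_def
  -- The thresholds are recomputed for `g₁`, so the progression is planted at a scale chosen after
  -- the prime comb. Here `γ = 0`, as the interval bound of the arithmetic comb carries no power of
  -- `L`.
  obtain ⟨L₁, hL₁, hamp'⟩ := hg₁.exists_amplify (d := d) (s := s) (ε := ε) (γ := 0)
    (θ := θ / 8) hA' hd1 hs0 hs1 hε le_rfl (by linarith) (by positivity)
  obtain ⟨C, hC, hpert⟩ := hg₁.exists_fourier_mul_sub_le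
  obtain ⟨L', Q, N, δ', M, hXL', hL1', hXQ, hQ1, hQN, hNQ, hδ', hM, hM1, hNδ, hcoef',
      hcoef'', hint'⟩ :=
    harith (max (max L₁ k) (8 * (C * A')))
  have hQ0 : 0 < Q := by linarith
  have hN0' : (0 : ℝ) < N := by linarith
  have hN0 : 0 < N := by exact_mod_cast hN0'
  have hδ0' : 0 < δ' := by rw [hδ']; positivity
  have hM0 : 0 < M := by rw [hM]; positivity
  have hcomb : IsTrig (comb {N} δ') (combCoeff {N} δ') :=
    isTrig_comb hδ0' (by simpa using ⟨hN0, by linarith⟩)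
  have hc0 := comb_nonneg {N} hδ0'.le
  have hcc0 : combCoeff {N} δ' 0 = 1 := combCoeff_zero (by simp) δ'
  obtain ⟨hg₂, hdiff₂, hmean₂⟩ := hamp' L'
    ((le_max_left _ _).trans ((le_max_left _ _).trans hXL'))
    (fun x => (1 - M) + M * comb {N} δ' x) _ ((IsTrig.const (1 - M)).add (hcomb.const_mul M))
    (fun x => add_nonneg (by linarith) (mul_nonneg hM0.le (hc0 x)))
    (by simp [hcc0]) (fun n hn => by
      rw [if_neg hn, zero_add]
      exact hcoef' n hn)
    (fun x _ r hr hr4 => by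
      rw [Real.rpow_zero, mul_one]
      exact hint' x r hr hr4)
  have hone : ∀ ξ : ℝ, (1 + |ξ|) ^ (-s) ≤ 1 := fun ξ =>
    Real.rpow_le_one_of_one_le_of_nonpos (by linarith [abs_nonneg ξ]) (by linarith)
  have hm₁ := abs_real_univ_sub_le ((hdiff₁ 0).trans
    (mul_le_of_le_one_right (by positivity) (hone 0)))
  have hm₂ := abs_real_univ_sub_le ((hdiff₂ 0).trans
    (mul_le_of_le_one_right (by positivity) (hone 0)))
  rw [abs_le] at hm₁ hm₂
  -- The comb without the factor `M` has no decaying coefficients, but only the frequency `ξ = 0`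
  -- matters here, and the growing bound (`s = -1`) suffices. The condition `Q ≥ 8 C A'` limits the
  -- error to `1/8`.
  have hm₃ : 3 / 8 ≤ ∫ x, g₁ x * comb {N} δ' x := by
    have h1 := hpert (comb {N} δ') _ hcomb hc0 hcc0 (A' * Q⁻¹) (-1) (by positivity) le_rfl
      (by norm_num) (fun n hn => by simpa using hcoef'' n hn) 0
    have h2 : C * (A' * Q⁻¹) ≤ 1 / 8 := by
      rw [← mul_assoc, ← div_eq_mul_inv, div_le_iff₀ hQ0]
      linarith [(le_max_right _ _).trans hXQ]
    have h3 := abs_real_univ_sub_le (h1.trans (by simpa using h2))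
    rw [(hg₁.mul hcomb hc0).real_univ, abs_le] at h3
    linarith
  obtain ⟨θ₁, hθ₁, hσ⟩ := exists_le_measure_nearProgression hg₁ hN0 hδ0' hNδ hM0 hM1 hm₃
  refine ⟨fun x => g₁ x * ((1 - M) + M * comb {N} δ' x), min (θ / 2) θ₁, hg₂, by positivity,
    min_le_left _ _, ?_, fun x hx => by simp [hg₁_def, hx], fun ξ => ?_, fun x hx r hr hr8 => ?_,
    ⟨⋃ q ∈ P, nearProgression q (2 * (q * δ)), ?_, ?_, fun x hx => ?_⟩,
    Q, N, ((le_max_right _ _).trans (le_max_left _ _)).trans hXQ, hQ1, hN0, hNQ,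
    fun σ hσf hσc => ?_⟩
  · have := min_le_left (θ / 2) θ₁
    linarith
  · refine (norm_sub_le_norm_sub_add_norm_sub _ (fourierMeasure (densMeasure g₁) ξ) _).trans ?_
    have h0 : 0 ≤ (1 + |ξ|) ^ (-s) := by positivity
    have := mul_nonneg hθ.le h0
    linarith [hdiff₁ ξ, hdiff₂ ξ]
  · have h0 : 0 ≤ r ^ (d - ε) := by positivity
    have := mul_nonneg hθ.le h0
    linarith [hmean₁ x hx r hr hr8, hmean₂ x hx r hr hr8]
  · exact P.finite_toSet.isClosed_biUnion fun q _ => isClosed_nearProgression _ _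
  · refine iUnion₂_subset fun q hq => ?_
    obtain ⟨h1, h2, -, h4⟩ := hPq q hq
    exact nearProgression_subset_approxBy h1 (by exact_mod_cast (le_max_right _ _).trans h2) h4
  · by_contra hne
    obtain ⟨q, hq, hxq⟩ := exists_mem_nearProgression_of_comb_ne_zero hδ (fun q hq => (hPq q hq).1)
      (right_ne_zero_of_mul (left_ne_zero_of_mul hne))
    exact hx (mem_iUnion₂.2 ⟨q, hq, hxq⟩)
  · rw [← hM, ← hδ']
    refine hσ σ hσf fun ξ => (hσc ξ).trans ?_
    gcongr
    exact min_le_right _ _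

/-! ### The limit measure -/

lemma exists_isDens_real_univ_eq_one : ∃ g, IsDens g ∧ (densMeasure g).real univ = 1 := by
  obtain ⟨C, hC, hb⟩ := exists_norm_bumpHat_le
  have hm := bumpMass_pos
  set w : ℝ := 1 / 16 with hw
  have hw0 : 0 < w := by norm_num
  set a : ℝ := (w * bumpMass)⁻¹ with ha
  have ha0 : 0 < a := by positivity
  set g : ℝ → ℝ := fun x => a * bump ((x - 1 / 4) / w) with hg
  have hcont : Continuous g :=
    continuous_const.mul (continuous_bump.comp (by fun_prop))
  have hnn : ∀ x, 0 ≤ g x := fun x => mul_nonneg ha0.le bump.nonneg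
  have hft : ∀ ξ : ℝ, fourierMeasure (densMeasure g) ξ =
      Complex.exp (-2 * (Real.pi : ℂ) * Complex.I * (1 / 4 : ℝ) * ξ) *
        (bumpHat (w * ξ) / bumpMass) := by
    intro ξ
    have h1 := integral_sub_right_eq_self (μ := volume) (fun y : ℝ => (a : ℂ) * (Complex.exp
      (-2 * (Real.pi : ℂ) * Complex.I * (1 / 4 : ℝ) * ξ) * (Complex.exp
      (-2 * (Real.pi : ℂ) * Complex.I * y * ξ) * (bump (y / w) : ℂ)))) (1 / 4 : ℝ)
    have h2 := Measure.integral_comp_div (fun y : ℝ =>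
      Complex.exp (-2 * (Real.pi : ℂ) * Complex.I * y * (w * ξ : ℝ)) * (bump y : ℂ)) w
    rw [← bumpHat_eq, abs_of_pos hw0, Complex.real_smul] at h2
    rw [fourierMeasure, integral_densMeasure hcont hnn]
    calc _ = _ := ?_
      _ = _ := h1
      _ = _ := ?_
    · congr 1 with x
      rw [hg, Complex.real_smul, ← mul_assoc (Complex.exp _), ← Complex.exp_add]
      push_cast
      rw [show (-2 * (Real.pi : ℂ) * Complex.I * (1 / 4) * ξ +
        -2 * (Real.pi : ℂ) * Complex.I * (x - 1 / 4) * ξ) =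
        -2 * (Real.pi : ℂ) * Complex.I * x * ξ by ring]
      ring
    · have hw' : (w : ℂ) ≠ 0 := by exact_mod_cast hw0.ne'
      have hm' : (bumpMass : ℂ) ≠ 0 := by exact_mod_cast hm.ne'
      have h3 : ∫ y : ℝ, Complex.exp (-2 * (Real.pi : ℂ) * Complex.I * y * ξ) *
          (bump (y / w) : ℂ) = w * bumpHat (w * ξ) := by
        rw [← h2]
        congr 1 with y
        congr 2
        push_cast
        field_simp
      rw [integral_const_mul, integral_const_mul, h3, ha]
      push_cast
      field_simp
  refine ⟨g, ⟨hcont, hnn, fun x hx => ?_, C / w ^ 5 / bumpMass, by positivity, fun ξ => ?_⟩, ?_⟩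
  · rw [hg]
    simp only
    rw [bump_eq_zero, mul_zero]
    rw [abs_div, abs_of_pos hw0, le_div_iff₀ hw0]
    by_contra! h
    rw [abs_lt] at h
    exact hx ⟨by linarith, by linarith⟩
  · rw [hft, norm_mul, norm_exp_neg_two_pi_I, one_mul, norm_div, Complex.norm_real,
      Real.norm_of_nonneg hm.le, div_right_comm _ bumpMass]
    gcongr
    refine (norm_bumpHat_scaled_le hC hb hw0 (by norm_num) ξ).trans ?_
    gcongr
    · linarith [abs_nonneg ξ]
    · norm_num
  · have h := hft 0
    rw [fourierMeasure_zero, mul_zero, bumpHat_zero, div_self (by exact_mod_cast hm.ne')] at h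
    simpa using h

/-- Extraction of a weak limit of a bounded sequence of densities. -/
lemma exists_weak_limit {g : ℕ → ℝ → ℝ} (hg : ∀ n, IsDens (g n)) (C : NNReal)
    (hmass : ∀ n, (densMeasure (g n)).real univ ≤ C) :
    ∃ ν : Measure ℝ, IsFiniteMeasure ν ∧
      (∀ ξ, Filter.Tendsto (fun n => fourierMeasure (densMeasure (g n)) ξ)
        (Filter.hyperfilter ℕ) (nhds (fourierMeasure ν ξ))) ∧
      (∀ c r, 0 < r → r ≤ 1 / 4 → Filter.Tendsto (fun n => bumpMean (densMeasure (g n)) c r)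
        (Filter.hyperfilter ℕ) (nhds (bumpMean ν c r))) ∧
      ∀ K, IsClosed K → (∀ᶠ n in Filter.atTop, ∀ x ∉ K, g n x = 0) →
        ν (baseInterval ∩ K)ᶜ = 0 := by
  set F : ℕ → FiniteMeasure ℝ := fun n => ⟨densMeasure (g n), (hg n).isFiniteMeasure⟩ with hF
  have hcpt : ∀ K : Set ℝ, IsClosed K →
      IsCompact {μ : FiniteMeasure ℝ | μ.mass ≤ C ∧ ∀ _ : ℕ, μ (baseInterval ∩ K)ᶜ ≤ 0} :=
    fun K hK => isCompact_setOfPred_finiteMeasure_mass_le_compl_isCompact_le (u := fun _ => 0)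
      (K := fun _ => baseInterval ∩ K) C tendsto_const_nhds (fun _ => isCompact_Icc.inter_right hK)
      (Or.inl inferInstance)
  have hmem : ∀ K : Set ℝ, IsClosed K → ∀ n, (∀ x ∉ K, g n x = 0) →
      F n ∈ {μ : FiniteMeasure ℝ | μ.mass ≤ C ∧ ∀ _ : ℕ, μ (baseInterval ∩ K)ᶜ ≤ 0} := by
    intro K hK n hn
    have hm : MeasurableSet (baseInterval ∩ K)ᶜ := (measurableSet_Icc.inter hK.measurableSet).compl
    refine ⟨?_, fun _ => ?_⟩
    · have := hmass n
      rw [← NNReal.coe_le_coe]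
      exact this
    · have h0 : densMeasure (g n) (baseInterval ∩ K)ᶜ = 0 := by
        rw [densMeasure, withDensity_apply _ hm,
          setLIntegral_congr_fun hm (g := 0) fun x hx => ?_]
        · simp
        · have : g n x = 0 := by
            by_cases hx1 : x ∈ baseInterval
            · exact hn x fun hx2 => hx ⟨hx1, hx2⟩
            · exact (hg n).eq_zero x hx1
          simp [this]
      rw [← ENNReal.coe_le_coe, FiniteMeasure.ennreal_coeFn_eq_coeFn_toMeasure]
      exact h0.le
  -- A limit along a fixed ultrafilter replaces the extraction of a subsequence.
  obtain ⟨ν, -, hν⟩ := (hcpt univ isClosed_univ).ultrafilter_le_nhds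
    (Ultrafilter.map F (Filter.hyperfilter ℕ)) (by
      rw [Filter.le_principal_iff, Ultrafilter.coe_map]
      exact Filter.mem_map.2 (Filter.univ_mem' fun n => hmem univ isClosed_univ n (by simp)))
  have hlim : Filter.Tendsto F (Filter.hyperfilter ℕ) (nhds ν) := hν
  refine ⟨ν, inferInstance, fun ξ => ?_, fun c r hr hr4 => ?_, fun K hK hev => ?_⟩
  · have h1 := (FiniteMeasure.tendsto_iff_forall_integral_rclike_tendsto ℂ).1 hlim
      (BoundedContinuousFunction.ofNormedAddCommGroup
        (fun x : ℝ => Complex.exp (-2 * (Real.pi : ℂ) * Complex.I * (x : ℂ) * (ξ : ℂ)))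
        (by fun_prop) 1 fun x => (norm_exp_neg_two_pi_I x ξ).le)
    exact h1
  · have h1 := FiniteMeasure.tendsto_iff_forall_integral_tendsto.1 hlim
      (BoundedContinuousFunction.ofNormedAddCommGroup (fun x : ℝ => perBump r (x - c))
        ((isTrig_perBump hr hr4).translate c).continuous 1 fun x => by
          rw [Real.norm_of_nonneg (perBump_nonneg _ _)]
          exact perBump_le_one _ _)
    exact h1
  -- Vanishing off the closed set `K` is part of a compact, hence closed, condition on measures, so
  -- it passes to the weak limit.
  · have h1 := (hcpt K hK).isClosed.mem_of_tendsto hlim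
      ((hev.filter_mono (Nat.hyperfilter_le_atTop)).mono fun n hn => hmem K hK n hn)
    have h2 := h1.2 0
    rw [← ENNReal.coe_le_coe, FiniteMeasure.ennreal_coeFn_eq_coeFn_toMeasure] at h2
    simpa using h2

/-- The finite measure obtained as the limit of the construction. -/
lemma exists_limit_measure {α β : ℝ} (hα : 0 < α) (hβ0 : 0 ≤ β) (hβ1 : β < 1) :
    ∃ ν : Measure ℝ, IsFiniteMeasure ν ∧ 1 / 2 ≤ ν.real univ ∧ ν.real univ ≤ 2 ∧
      ν baseIntervalᶜ = 0 ∧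
      (∀ k : ℕ, ∃ K, IsClosed K ∧ K ⊆ approxBy α k ∧ ν Kᶜ = 0) ∧
      (∀ ε : ℝ, 0 < ε → ∃ C : ℝ, 0 < C ∧
        ∀ ξ : ℝ, ‖fourierMeasure ν ξ‖ ≤ C * (1 + |ξ|) ^ (-((1 - β) / (2 + α)) + ε)) ∧
      (∀ ε : ℝ, 0 < ε → ∃ C : ℝ, 0 < C ∧ ∀ x ∈ baseInterval, ∀ r : ℝ, 0 < r → r ≤ 1 / 8 →
        bumpMean ν x r ≤ C * r ^ (2 / (2 + α) - ε)) ∧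
      ∀ k : ℕ, ∃ (Q : ℝ) (N : ℕ), k ≤ Q ∧ 1 ≤ Q ∧ 0 < N ∧ (N : ℝ) ≤ 2 * Q ^ (1 + β) ∧
        1 / 8 * Q ^ (-(1 - β)) ≤ ν.real (nearProgression N (4 * (N * Q ^ (-(2 + α))))) := by
  set τ := (1 - β) / (2 + α) with hτ
  set d := 2 / (2 + α) with hd
  have hτ0 : 0 < τ := div_pos (by linarith) (by linarith)
  have hτ1 : τ ≤ 1 := by rw [hτ, div_le_one (by linarith)]; linarith
  have hd1 : d ≤ 1 := by rw [hd, div_le_one (by linarith)]; linarith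
  -- The losses never exceed `τ`, as each step requires, and tend to `0`, so that the limit attains
  -- every exponent short of the optimal one.
  set ε : ℕ → ℝ := fun k => τ / (k + 1) with hε
  have hε0 : ∀ k, 0 < ε k := fun k => by positivity
  have hετ : ∀ k, ε k ≤ τ := fun k =>
    div_le_self hτ0.le (by linarith [(Nat.cast_nonneg k : (0 : ℝ) ≤ k)])
  have hεanti : ∀ {j k}, k ≤ j → ε j ≤ ε k := fun {j k} h => by
    have : (k : ℝ) ≤ j := by exact_mod_cast h
    exact div_le_div_of_nonneg_left hτ0.le (by positivity) (by linarith)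
  have hεlim : ∀ η : ℝ, 0 < η → ∃ k, ε k ≤ η := fun η hη => by
    obtain ⟨k, hk⟩ := exists_nat_ge (τ / η)
    refine ⟨k, ?_⟩
    rw [div_le_iff₀ hη] at hk
    rw [hε]
    simp only
    rw [div_le_iff₀ (by positivity)]
    nlinarith
  let S := {p : (ℝ → ℝ) × ℝ // IsDens p.1 ∧ 0 < p.2 ∧ 1 / 2 + 2 * p.2 ≤ (densMeasure p.1).real univ}
  have step : ∀ (k : ℕ) (p : S), ∃ p' : S, p'.1.2 ≤ p.1.2 / 2 ∧
      (∀ x, p.1.1 x = 0 → p'.1.1 x = 0) ∧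
      (∀ ξ, ‖fourierMeasure (densMeasure p'.1.1) ξ - fourierMeasure (densMeasure p.1.1) ξ‖ ≤
        p.1.2 * (1 + |ξ|) ^ (-(τ - ε k))) ∧
      (∀ x ∈ baseInterval, ∀ r : ℝ, 0 < r → r ≤ 1 / 8 →
        bumpMean (densMeasure p'.1.1) x r ≤
          bumpMean (densMeasure p.1.1) x r + p.1.2 * r ^ (d - ε k)) ∧
      (∃ K, IsClosed K ∧ K ⊆ approxBy α k ∧ ∀ x ∉ K, p'.1.1 x = 0) ∧
      ∃ (Q : ℝ) (N : ℕ), k ≤ Q ∧ 1 ≤ Q ∧ 0 < N ∧ (N : ℝ) ≤ 2 * Q ^ (1 + β) ∧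
        ∀ σ : Measure ℝ, IsFiniteMeasure σ →
          (∀ ξ, ‖fourierMeasure σ ξ - fourierMeasure (densMeasure p'.1.1) ξ‖ ≤ 2 * p'.1.2) →
          1 / 8 * Q ^ (-(1 - β)) ≤ σ.real (nearProgression N (4 * (N * Q ^ (-(2 + α))))) := by
    rintro k ⟨⟨g, θ⟩, hg, hθ, hm⟩
    obtain ⟨g', θ', h1, h2, h3, h4, h5⟩ :=
      exists_step hα hβ0 hβ1 (hε0 k) ((hετ k).trans hτ1) (hετ k) hθ k hg hm
    exact ⟨⟨⟨g', θ'⟩, h1, h2, h4⟩, h3, h5⟩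
  choose next hnext using step
  obtain ⟨g₀, hg₀, hm₀⟩ := exists_isDens_real_univ_eq_one
  -- The tolerance `1/4` makes the mass invariant an equality for `g₀`, and keeps the total drift of
  -- the mass below `2 · 1/4`.
  let st : ℕ → S := fun n => Nat.rec ⟨⟨g₀, 1 / 4⟩, hg₀, by norm_num, by rw [hm₀]; norm_num⟩
    (fun k p => next k p) n
  set g : ℕ → ℝ → ℝ := fun n => (st n).1.1 with hg_def
  set θ : ℕ → ℝ := fun n => (st n).1.2 with hθ_def
  have hg : ∀ n, IsDens (g n) := fun n => (st n).2.1
  have hθ : ∀ n, 0 < θ n := fun n => (st n).2.2.1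
  have hrel := fun n => hnext n (st n)
  have hhalf : ∀ n, θ (n + 1) ≤ θ n / 2 := fun n => (hrel n).1
  have hzero : ∀ n x, g n x = 0 → g (n + 1) x = 0 := fun n => (hrel n).2.1
  have hdiff : ∀ n ξ, ‖fourierMeasure (densMeasure (g (n + 1))) ξ -
      fourierMeasure (densMeasure (g n)) ξ‖ ≤ θ n * (1 + |ξ|) ^ (-(τ - ε n)) :=
    fun n => (hrel n).2.2.1
  have hmean : ∀ n, ∀ x ∈ baseInterval, ∀ r : ℝ, 0 < r → r ≤ 1 / 8 →
      bumpMean (densMeasure (g (n + 1))) x r ≤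
        bumpMean (densMeasure (g n)) x r + θ n * r ^ (d - ε n) := fun n => (hrel n).2.2.2.1
  -- Halving gives `θ n ≤ 2 θ n - 2 θ (n + 1)`, so the errors telescope. Later steps have smaller
  -- losses `ε n`, hence satisfy the estimate with `ε k`.
  have hdiff' : ∀ k n, k ≤ n → ∀ ξ, ‖fourierMeasure (densMeasure (g n)) ξ -
      fourierMeasure (densMeasure (g k)) ξ‖ ≤ (2 * θ k - 2 * θ n) * (1 + |ξ|) ^ (-(τ - ε k)) := by
    intro k n hkn ξ
    induction n, hkn using Nat.le_induction with
    | base => simp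
    | succ n hkn ih =>
      have h1 : (1 + |ξ|) ^ (-(τ - ε n)) ≤ (1 + |ξ|) ^ (-(τ - ε k)) :=
        Real.rpow_le_rpow_of_exponent_le (by linarith [abs_nonneg ξ]) (by linarith [hεanti hkn])
      have h2 : 0 ≤ (1 + |ξ|) ^ (-(τ - ε k)) := by positivity
      calc _ ≤ _ := norm_sub_le_norm_sub_add_norm_sub _ (fourierMeasure (densMeasure (g n)) ξ) _
        _ ≤ θ n * (1 + |ξ|) ^ (-(τ - ε k)) +
            (2 * θ k - 2 * θ n) * (1 + |ξ|) ^ (-(τ - ε k)) := by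
          refine add_le_add ((hdiff n ξ).trans ?_) ih
          exact mul_le_mul_of_nonneg_left h1 (hθ n).le
        _ = (2 * θ k - θ n) * (1 + |ξ|) ^ (-(τ - ε k)) := by ring
        _ ≤ _ := mul_le_mul_of_nonneg_right (by linarith [hhalf n]) h2
  have hmean' : ∀ k n, k ≤ n → ∀ x ∈ baseInterval, ∀ r : ℝ, 0 < r → r ≤ 1 / 8 →
      bumpMean (densMeasure (g n)) x r ≤
        bumpMean (densMeasure (g k)) x r + (2 * θ k - 2 * θ n) * r ^ (d - ε k) := by
    intro k n hkn x hx r hr hr8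
    induction n, hkn using Nat.le_induction with
    | base => simp
    | succ n hkn ih =>
      have h1 : r ^ (d - ε n) ≤ r ^ (d - ε k) :=
        Real.rpow_le_rpow_of_exponent_ge hr (by linarith) (by linarith [hεanti hkn])
      have h2 : 0 ≤ r ^ (d - ε k) := by positivity
      have h3 := mul_le_mul_of_nonneg_left h1 (hθ n).le
      have h4 := mul_le_mul_of_nonneg_right (by linarith [hhalf n] :
        θ n + (2 * θ k - 2 * θ n) ≤ 2 * θ k - 2 * θ (n + 1)) h2
      rw [add_mul] at h4
      linarith [hmean n x hx r hr hr8]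
  have hzero' : ∀ k n, k ≤ n → ∀ x, g k x = 0 → g n x = 0 := by
    intro k n hkn x hx
    induction n, hkn using Nat.le_induction with
    | base => exact hx
    | succ n hkn ih => exact hzero n x ih
  have hclose : ∀ k n, k ≤ n → ∀ ξ, ‖fourierMeasure (densMeasure (g n)) ξ -
      fourierMeasure (densMeasure (g k)) ξ‖ ≤ 2 * θ k * (1 + |ξ|) ^ (-(τ - ε k)) :=
    fun k n hkn ξ => (hdiff' k n hkn ξ).trans
      (mul_le_mul_of_nonneg_right (by linarith [hθ n]) (by positivity))
  have hone : ∀ k (ξ : ℝ), (1 + |ξ|) ^ (-(τ - ε k)) ≤ 1 := fun k ξ =>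
    Real.rpow_le_one_of_one_le_of_nonpos (by linarith [abs_nonneg ξ]) (by linarith [hετ k])
  have hg0 : g 0 = g₀ := rfl
  have hθ0 : θ 0 = 1 / 4 := rfl
  have hmass : ∀ n, (densMeasure (g n)).real univ ≤ 2 := by
    intro n
    have h1 := abs_real_univ_sub_le ((hclose 0 n (Nat.zero_le n) 0).trans
      (mul_le_of_le_one_right (by linarith [hθ 0]) (hone 0 0)))
    rw [hg0, hm₀, hθ0, abs_le] at h1
    linarith
  obtain ⟨ν, hν, hlim, hlim', hsupp⟩ := exists_weak_limit hg 2 (by simpa using hmass)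
  have hU : (Filter.hyperfilter ℕ : Filter ℕ) ≤ Filter.atTop := Nat.hyperfilter_le_atTop
  have hνclose : ∀ k ξ, ‖fourierMeasure ν ξ - fourierMeasure (densMeasure (g k)) ξ‖ ≤
      2 * θ k * (1 + |ξ|) ^ (-(τ - ε k)) := fun k ξ =>
    le_of_tendsto ((hlim ξ).sub_const _).norm
      (((Filter.eventually_ge_atTop k).filter_mono hU).mono fun n hn => hclose k n hn ξ)
  have hνmean : ∀ k, ∀ x ∈ baseInterval, ∀ r : ℝ, 0 < r → r ≤ 1 / 8 →
      bumpMean ν x r ≤ bumpMean (densMeasure (g k)) x r + 2 * θ k * r ^ (d - ε k) :=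
    fun k x hx r hr hr8 => le_of_tendsto (hlim' x r hr (by linarith))
      (((Filter.eventually_ge_atTop k).filter_mono hU).mono fun n hn =>
        (hmean' k n hn x hx r hr hr8).trans (by
          have : (2 * θ k - 2 * θ n) * r ^ (d - ε k) ≤ 2 * θ k * r ^ (d - ε k) :=
            mul_le_mul_of_nonneg_right (by linarith [hθ n]) (by positivity)
          linarith))
  have hνmass : |ν.real univ - 1| ≤ 1 / 2 := by
    have h1 := abs_real_univ_sub_le ((hνclose 0 0).trans
      (mul_le_of_le_one_right (by linarith [hθ 0]) (hone 0 0)))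
    rw [hg0, hm₀, hθ0] at h1
    linarith
  rw [abs_le] at hνmass
  have hsupp' : ∀ K, IsClosed K → (∀ᶠ n in Filter.atTop, ∀ x ∉ K, g n x = 0) → ν Kᶜ = 0 :=
    fun K hK hev => measure_mono_null (compl_subset_compl.2 inter_subset_right) (hsupp K hK hev)
  refine ⟨ν, hν, by linarith, by linarith, ?_, fun k => ?_, fun η hη => ?_, fun η hη => ?_,
    fun k => ?_⟩
  · exact hsupp' _ isClosed_Icc (Filter.Eventually.of_forall fun n => (hg n).eq_zero)
  · obtain ⟨K, hK, hKα, hgK⟩ := (hrel k).2.2.2.2.1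
    refine ⟨K, hK, hKα, hsupp' K hK ?_⟩
    filter_upwards [Filter.eventually_ge_atTop (k + 1)] with n hn x hx
    exact hzero' (k + 1) n hn x (hgK x hx)
  -- Starting at a stage with `ε k ≤ η`, the density `g k` has cubic decay and all later corrections
  -- decay at the required rate.
  · obtain ⟨k, hk⟩ := hεlim η hη
    obtain ⟨C, hC, hdec⟩ := (hg k).decay
    refine ⟨C + 2 * θ k, by linarith [hθ k], fun ξ => ?_⟩
    have hb : 1 ≤ 1 + |ξ| := by linarith [abs_nonneg ξ]
    have h1 : (1 + |ξ|) ^ (-(τ - ε k)) ≤ (1 + |ξ|) ^ (-τ + η) :=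
      Real.rpow_le_rpow_of_exponent_le hb (by linarith)
    have h2 : C / (1 + |ξ|) ^ 3 ≤ C * (1 + |ξ|) ^ (-τ + η) := by
      rw [div_eq_mul_inv, ← Real.rpow_natCast, ← Real.rpow_neg (by positivity)]
      gcongr
      · push_cast
        linarith
    calc ‖fourierMeasure ν ξ‖ ≤ ‖fourierMeasure (densMeasure (g k)) ξ‖ +
          ‖fourierMeasure ν ξ - fourierMeasure (densMeasure (g k)) ξ‖ :=
          norm_le_norm_add_norm_sub' _ _
      _ ≤ C * (1 + |ξ|) ^ (-τ + η) + 2 * θ k * (1 + |ξ|) ^ (-τ + η) := by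
          refine add_le_add ((hdec ξ).trans h2) ((hνclose k ξ).trans ?_)
          exact mul_le_mul_of_nonneg_left h1 (by linarith [hθ k])
      _ = _ := by ring
  · obtain ⟨k, hk⟩ := hεlim η hη
    obtain ⟨D, hD, hgD⟩ := (hg k).exists_bound
    refine ⟨4 * D + 2 * θ k, by linarith [hθ k], fun x hx r hr hr8 => ?_⟩
    have h1 : bumpMean (densMeasure (g k)) x r ≤ D * (4 * r) := by
      have h2 := bumpMean_mul_le (F := fun _ => 1) (hg k) (by simpa using hg k) continuous_const
        (fun _ => zero_le_one) hgD hx hr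
      simp only [mul_one] at h2
      refine h2.trans ?_
      gcongr
      rw [setIntegral_const, smul_eq_mul, mul_one]
      calc _ ≤ volume.real (Icc (x - 2 * r) (x + 2 * r)) :=
            measureReal_mono inter_subset_left isCompact_Icc.measure_ne_top
        _ = 4 * r := by
            rw [Real.volume_real_Icc_of_le (by linarith)]
            ring
    have h3 : r ≤ r ^ (d - η) := by
      simpa using Real.rpow_le_rpow_of_exponent_ge hr (by linarith) (by linarith : d - η ≤ 1)
    have h4 : r ^ (d - ε k) ≤ r ^ (d - η) :=
      Real.rpow_le_rpow_of_exponent_ge hr (by linarith) (by linarith)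
    calc bumpMean ν x r ≤ D * (4 * r) + 2 * θ k * r ^ (d - ε k) :=
          (hνmean k x hx r hr hr8).trans (by linarith)
      _ ≤ D * (4 * r ^ (d - η)) + 2 * θ k * r ^ (d - η) := by
          have := (hθ k).le
          gcongr
      _ = _ := by ring
  · obtain ⟨Q, N, h1, h2, h3, h4, h5⟩ := (hrel k).2.2.2.2.2
    refine ⟨Q, N, h1, h2, h3, h4, h5 ν hν fun ξ => (hνclose (k + 1) ξ).trans ?_⟩
    exact mul_le_of_le_one_right (by linarith [hθ (k + 1)]) (hone _ _)

/-! ### Properties of the limit measure -/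

/-- Approximations with arbitrarily large denominators give infinitely many pairs, as their first
coordinates are unbounded. -/
lemma mem_wellApproxSet_of_forall_approxBy {α x : ℝ} (h : ∀ k, x ∈ approxBy α k) :
    x ∈ wellApproxSet α := by
  refine Set.Infinite.of_image Prod.fst (Set.infinite_of_forall_exists_gt fun a => ?_)
  obtain ⟨q, r, hq, hk, hx⟩ := h (a.toNat + 1)
  refine ⟨q, ⟨((q : ℤ), r), ⟨by simpa using hq.ne', ?_⟩, rfl⟩, by omega⟩
  simpa using hx

/-- Intervals of length at least `1/8`, including unbounded ones, are covered by the constant `8 ^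
t`. A shorter interval of length `v` lies within `v` of any of its points in `baseInterval`; letting
`r` decrease to `v` also treats the degenerate case `v = 0`. -/
lemma measure_le_of_bumpMean_le {μ : Measure ℝ} [IsProbabilityMeasure μ]
    (hμ : μ baseIntervalᶜ = 0) {C t : ℝ} (hC : 0 < C) (ht : 0 < t)
    (h : ∀ x ∈ baseInterval, ∀ r : ℝ, 0 < r → r ≤ 1 / 8 → bumpMean μ x r ≤ C * r ^ t)
    {I : Set ℝ} (hI : I.OrdConnected) :
    μ I ≤ ENNReal.ofReal (C + 8 ^ t) * volume I ^ t := by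
  rcases le_or_gt (ENNReal.ofReal (1 / 8)) (volume I) with hv | hv
  · calc μ I ≤ 1 := prob_le_one
      _ = ENNReal.ofReal (8 ^ t) * ENNReal.ofReal (1 / 8) ^ t := by
        rw [ENNReal.ofReal_rpow_of_pos (by norm_num), ← ENNReal.ofReal_mul (by positivity),
          ← Real.mul_rpow (by norm_num) (by norm_num)]
        norm_num
      _ ≤ _ := by
        gcongr
        linarith
  · have hfin : volume I ≠ ∞ := (hv.trans ENNReal.ofReal_lt_top).ne
    set v := (volume I).toReal with hvdef
    have hv8 : v < 1 / 8 := by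
      rw [← ENNReal.ofReal_toReal hfin] at hv
      exact (ENNReal.ofReal_lt_ofReal_iff (by norm_num)).1 hv
    have hv0 : 0 ≤ v := ENNReal.toReal_nonneg
    rcases (I ∩ baseInterval).eq_empty_or_nonempty with he | ⟨c, hcI, hcJ⟩
    · have : μ I = 0 := measure_mono_null (t := baseIntervalᶜ)
        (fun x hx hxJ => by
          have : x ∈ I ∩ baseInterval := ⟨hx, hxJ⟩
          rw [he] at this
          exact this) hμ
      simp [this]
    · have key : ∀ r, v < r → r ≤ 1 / 8 → μ.real I ≤ C * r ^ t := by
        intro r hvr hr8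
        have hr : 0 < r := hv0.trans_lt hvr
        refine le_trans ?_ (h c hcJ r hr hr8)
        have hsub : ∀ x ∈ I, |x - c| ≤ r := by
          intro x hx
          have h1 : uIcc c x ⊆ I := hI.uIcc_subset hcI hx
          have h2 := measure_mono (μ := volume) h1
          rw [Real.volume_interval] at h2
          have h3 := ENNReal.toReal_mono hfin h2
          rw [ENNReal.toReal_ofReal (abs_nonneg _)] at h3
          linarith
        have hm : MeasurableSet I := hI.measurableSet
        rw [← integral_indicator_one hm, bumpMean]
        have hcont : Continuous fun x : ℝ => perBump r (x - c) :=
          ((isTrig_perBump hr (by linarith)).translate c).continuous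
        refine integral_mono_ae ((integrable_const (1 : ℝ)).indicator hm)
          (Integrable.of_bound (C := 1) hcont.aestronglyMeasurable
            (Filter.Eventually.of_forall fun x => ?_)) ?_
        · rw [Real.norm_of_nonneg (perBump_nonneg _ _)]
          exact perBump_le_one _ _
        · have hae : ∀ᵐ x ∂μ, x ∈ baseInterval := by
            rw [ae_iff]
            exact hμ
          filter_upwards [hae] with x hxJ
          by_cases hx : x ∈ I
          · rw [indicator_of_mem hx, perBump_of_abs_le (abs_sub_le_of_mem_baseInterval hxJ hcJ),
              bump_eq_one]
            · simp
            · rw [abs_div, abs_of_pos hr]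
              exact (div_le_one hr).2 (hsub x hx)
          · rw [indicator_of_notMem hx]
            exact perBump_nonneg _ _
      have hlim : μ.real I ≤ C * v ^ t := by
        have h1 : Filter.Tendsto (fun r : ℝ => C * r ^ t) (nhdsWithin v (Ioi v))
            (nhds (C * v ^ t)) :=
          ((Real.continuousAt_rpow_const v t (Or.inr ht.le)).tendsto.mono_left
            nhdsWithin_le_nhds).const_mul C
        refine ge_of_tendsto h1 ?_
        filter_upwards [Ioc_mem_nhdsGT hv8] with r hr
        exact key r hr.1 hr.2
      calc μ I = ENNReal.ofReal (μ.real I) := (ofReal_measureReal).symm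
        _ ≤ ENNReal.ofReal (C * v ^ t) := ENNReal.ofReal_le_ofReal hlim
        _ = ENNReal.ofReal C * volume I ^ t := by
          rw [ENNReal.ofReal_mul hC.le, ← ENNReal.ofReal_rpow_of_nonneg hv0 ht.le, hvdef,
            ENNReal.ofReal_toReal hfin]
        _ ≤ _ := by
          gcongr
          exact le_add_of_nonneg_right (by positivity)

/-! ### Lower bounds for the extension quotients -/

/-- The Fourier transform of the restriction of `μ` to a neighbourhood of a progression is large
near the multiples of `N`. -/
lemma half_le_norm_fourierDensity {μ : Measure ℝ} [IsFiniteMeasure μ] (hμ : μ baseIntervalᶜ = 0)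
    {N j : ℕ} {w η : ℝ} (hjw : j * w ≤ 1 / 12) (hη0 : 0 ≤ η) (hη : η ≤ 1 / 6) :
    1 / 2 * μ.real (nearProgression N w) ≤
      ‖fourierDensity ((nearProgression N w).indicator fun _ => 1) μ (j * N + η)‖ := by
  set A := nearProgression N w with hA
  have hm : MeasurableSet A := (isClosed_nearProgression N w).measurableSet
  refine le_trans ?_ (Complex.re_le_norm _)
  set f : ℝ → ℂ := fun x => Complex.exp (-2 * (Real.pi : ℂ) * Complex.I * (x : ℂ) *
    ((j * N + η : ℝ) : ℂ)) * ((A.indicator (fun _ => (1 : ℝ)) x : ℝ) : ℂ) with hf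
  have hint : Integrable f μ := by
    refine (integrable_exp_neg_two_pi_I μ (j * N + η)).mul_bdd (c := 1) ?_ ?_
    · exact (Complex.measurable_ofReal.comp (measurable_const.indicator hm)).aestronglyMeasurable
    · refine Filter.Eventually.of_forall fun x => ?_
      by_cases hx : x ∈ A <;> simp [hx]
  have hre : (∫ x, f x ∂μ).re = ∫ x, (f x).re ∂μ := (Complex.reCLM.integral_comp_comm hint).symm
  have hfd : fourierDensity (A.indicator fun _ => 1) μ (j * N + η) = ∫ x, f x ∂μ := by
    rw [fourierDensity]
  rw [hfd, hre, mul_comm, ← smul_eq_mul, ← integral_indicator_const _ hm]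
  refine integral_mono_ae ((integrable_const _).indicator hm) hint.re ?_
  have hae : ∀ᵐ x ∂μ, x ∈ baseInterval := by
    rw [ae_iff]
    exact hμ
  filter_upwards [hae] with x hxJ
  by_cases hx : x ∈ A
  · rw [indicator_of_mem hx]
    have hfx : (f x).re = Real.cos (2 * Real.pi * (x * (j * N + η))) := by
      simp only [hf, indicator_of_mem hx, Complex.ofReal_one, mul_one]
      rw [show (-2 * (Real.pi : ℂ) * Complex.I * x * ((j * N + η : ℝ) : ℂ)) =
        ((-(2 * Real.pi * (x * (j * N + η))) : ℝ) : ℂ) * Complex.I by push_cast; ring,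
        Complex.exp_ofReal_mul_I_re, Real.cos_neg]
    change 1 / 2 ≤ (f x).re
    rw [hfx]
    set u := (N : ℝ) * x - round ((N : ℝ) * x) with hu
    have hu' : |u| ≤ w := hx
    -- Modulo full turns the phase is that of `j u + x η`, at most `1/12 + 3/8 · 1/6 < 1/6` of a
    -- turn, where the cosine is at least `1/2`.
    have hphase : 2 * Real.pi * (x * (j * N + η)) =
        2 * Real.pi * (j * u + x * η) + ((j * round ((N : ℝ) * x) : ℤ) : ℝ) * (2 * Real.pi) := by
      rw [hu]
      push_cast
      ring
    rw [hphase, Real.cos_add_int_mul_two_pi, ← Real.cos_abs, ← Real.cos_pi_div_three]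
    obtain ⟨hx1, hx2⟩ := hxJ
    have h1 : |j * u + x * η| ≤ 1 / 6 := by
      calc |j * u + x * η| ≤ |j * u| + |x * η| := abs_add_le _ _
        _ = j * |u| + x * η := by
          rw [abs_mul, Nat.abs_cast, abs_of_nonneg (mul_nonneg (by linarith) hη0)]
        _ ≤ j * w + 3 / 8 * (1 / 6) := by gcongr
        _ ≤ 1 / 6 := by linarith
    have hpi := Real.pi_pos
    refine Real.cos_le_cos_of_nonneg_of_le_pi (abs_nonneg _) (by linarith) ?_
    rw [abs_mul, abs_of_pos (by positivity)]
    calc 2 * Real.pi * |j * u + x * η| ≤ 2 * Real.pi * (1 / 6) := by gcongr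
      _ = Real.pi / 3 := by ring
  · rw [indicator_of_notMem hx]
    simp [hf, hx]

/-- The transform is large on intervals of length `1/6` starting at `jN` for every `j ≤ 1/(12w)`.
They are disjoint because `N ≥ 1`, and have total length at least `1/(72w)`. -/
lemma ofReal_le_eLpNorm_fourierDensity {μ : Measure ℝ} [IsFiniteMeasure μ]
    (hμ : μ baseIntervalᶜ = 0) {N : ℕ} (hN : 0 < N) {w : ℝ} (hw : 0 < w) {p : ℝ≥0∞} (hp0 : p ≠ 0)
    (hp : p ≠ ∞) :
    ENNReal.ofReal (1 / 2 * μ.real (nearProgression N w) * (1 / (72 * w)) ^ (1 / p.toReal)) ≤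
      eLpNorm (fourierDensity ((nearProgression N w).indicator fun _ => 1) μ) p volume := by
  set a := 1 / 2 * μ.real (nearProgression N w) with ha
  have ha0 : 0 ≤ a := by positivity
  set J := ⌊1 / (12 * w)⌋₊ + 1 with hJ
  have hJle : 1 / (12 * w) ≤ J := by
    rw [hJ]
    push_cast
    exact (Nat.lt_floor_add_one _).le
  set S : Set ℝ := ⋃ j ∈ Finset.range J, Icc ((j : ℝ) * N) (j * N + 1 / 6) with hS
  have hSm : MeasurableSet S := Finset.measurableSet_biUnion _ fun _ _ => measurableSet_Icc
  have hN1 : (1 : ℝ) ≤ N := by exact_mod_cast hN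
  have hdisj : (↑(Finset.range J) : Set ℕ).PairwiseDisjoint
      fun j : ℕ => Icc ((j : ℝ) * N) (j * N + 1 / 6) := by
    have hlt : ∀ i j : ℕ, i < j → Disjoint (Icc ((i : ℝ) * N) (i * N + 1 / 6))
        (Icc ((j : ℝ) * N) (j * N + 1 / 6)) := by
      intro i j hij
      rw [Set.disjoint_left]
      rintro x ⟨_, h2⟩ ⟨h3, _⟩
      have : (i : ℝ) + 1 ≤ j := by exact_mod_cast hij
      nlinarith
    intro i _ j _ hij
    rcases lt_or_gt_of_ne hij with h | h
    · exact hlt i j h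
    · exact (hlt j i h).symm
  have hvol : ENNReal.ofReal (1 / (72 * w)) ≤ volume S := by
    rw [hS, measure_biUnion_finset hdisj fun _ _ => measurableSet_Icc]
    simp only [Real.volume_Icc, add_sub_cancel_left, Finset.sum_const, Finset.card_range,
      nsmul_eq_mul]
    rw [← ENNReal.ofReal_natCast, ← ENNReal.ofReal_mul (by positivity)]
    refine ENNReal.ofReal_le_ofReal ?_
    calc 1 / (72 * w) = 1 / (12 * w) * (1 / 6) := by field_simp; norm_num
      _ ≤ J * (1 / 6) := by gcongr
  calc ENNReal.ofReal (a * (1 / (72 * w)) ^ (1 / p.toReal))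
      = ENNReal.ofReal a * ENNReal.ofReal (1 / (72 * w)) ^ (1 / p.toReal) := by
        rw [ENNReal.ofReal_mul ha0, ENNReal.ofReal_rpow_of_pos (by positivity)]
    _ ≤ ENNReal.ofReal a * volume S ^ (1 / p.toReal) := by gcongr
    _ = eLpNorm (S.indicator fun _ => a) p volume := by
        rw [eLpNorm_indicator_const hSm hp0 hp, Real.enorm_of_nonneg ha0]
    _ ≤ _ := by
        refine eLpNorm_mono fun ξ => ?_
        by_cases hξ : ξ ∈ S
        · rw [indicator_of_mem hξ, Real.norm_of_nonneg ha0]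
          obtain ⟨j, hj, hξ1, hξ2⟩ := mem_iUnion₂.1 hξ
          have hjw : j * w ≤ 1 / 12 := by
            have h1 : j ≤ ⌊1 / (12 * w)⌋₊ := Nat.lt_succ_iff.1 (Finset.mem_range.1 hj)
            have h2 := (Nat.le_floor_iff (by positivity)).1 h1
            calc j * w ≤ 1 / (12 * w) * w := by gcongr
              _ = 1 / 12 := by field_simp
          have := half_le_norm_fourierDensity hμ (N := N) hjw (η := ξ - j * N) (by linarith)
            (by linarith)
          rwa [add_sub_cancel] at this
        · rw [indicator_of_notMem hξ, norm_zero]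
          positivity

/-- This is `p < p₊(q)` cleared of denominators. At `q = ∞` the convention `1 / 0 = 0` gives the
correct value `1 - 1/q = 1`; at `q = 1` that factor is `0` and nothing is required of a finite `p`.
-/
lemma exponent_lt_of_lt_pPlus {α β : ℝ} (hα : 0 < α) (hβ1 : β < 1) {p q : ℝ≥0∞} (hq : 1 ≤ q)
    (hp : p < pPlus α β q) : p.toReal * ((1 - 1 / q.toReal) * (1 - β)) < 1 + α - β := by
  have hR : 0 < 1 - β := by linarith
  have hpos : 0 < 1 + α - β := by linarith
  rcases eq_or_ne q ∞ with rfl | hqt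
  · rw [pPlus] at hp
    rw [ENNReal.conjExponent, ENNReal.top_sub ENNReal.one_ne_top, ENNReal.inv_top, add_zero,
      one_mul] at hp
    have h1 := (ENNReal.lt_ofReal_iff_toReal_lt hp.ne_top).1 hp
    rw [lt_div_iff₀ hR] at h1
    simpa using h1
  · rcases hq.eq_or_lt with rfl | hq1
    · simpa using hpos
    · set t := q.toReal with ht
      have hqt' : q = ENNReal.ofReal t := (ENNReal.ofReal_toReal hqt).symm
      have ht1 : 1 < t := by
        rw [hqt', ← ENNReal.ofReal_one] at hq1
        exact (ENNReal.ofReal_lt_ofReal_iff_of_nonneg zero_le_one).1 hq1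
      have hconj : ENNReal.conjExponent q = ENNReal.ofReal (t / (t - 1)) := by
        rw [ENNReal.conjExponent, hqt', ← ENNReal.ofReal_one, ← ENNReal.ofReal_sub _ zero_le_one,
          ← ENNReal.ofReal_inv_of_pos (by linarith), ← ENNReal.ofReal_add zero_le_one
            (inv_nonneg.2 (by linarith))]
        congr 1
        have : t - 1 ≠ 0 := by linarith
        field_simp
        ring
      have ht0 : 0 < t - 1 := by linarith
      rw [pPlus, hconj, ← ENNReal.ofReal_mul (by positivity)] at hp
      have h1 := (ENNReal.lt_ofReal_iff_toReal_lt hp.ne_top).1 hp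
      rw [div_mul_div_comm, lt_div_iff₀ (by positivity)] at h1
      have ht' : 0 < t := by linarith
      rw [show p.toReal * ((1 - 1 / t) * (1 - β)) = p.toReal * ((t - 1) * (1 - β)) / t by
        field_simp, div_lt_iff₀ ht']
      linarith

lemma iSup_eq_top_of_rpow_le {F : ℕ → ℝ≥0∞} {Q : ℕ → ℝ} {c e : ℝ} (hc : 0 < c) (he : 0 < e)
    (hQ : ∀ k : ℕ, (k : ℝ) ≤ Q k) (hF : ∀ k, ENNReal.ofReal (c * Q k ^ e) ≤ F k) :
    ⨆ k, F k = ∞ := by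
  refine iSup_eq_top.2 fun b hb => ?_
  have h1 : Filter.Tendsto (fun k : ℕ => c * (k : ℝ) ^ e) Filter.atTop Filter.atTop :=
    ((tendsto_rpow_atTop he).comp tendsto_natCast_atTop_atTop).const_mul_atTop hc
  obtain ⟨k, hk⟩ : ∃ k : ℕ, b.toReal < c * (k : ℝ) ^ e := (h1.eventually_gt_atTop b.toReal).exists
  refine ⟨k, lt_of_lt_of_le ?_ (hF k)⟩
  refine (ENNReal.lt_ofReal_iff_toReal_lt hb.ne).2 (hk.trans_le ?_)
  gcongr
  exact hQ k

/-- Lower bound for the extension quotients of the indicators of neighbourhoods of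
progressions. -/
lemma ofReal_le_quotient {μ : Measure ℝ} [IsFiniteMeasure μ] (hμ : μ baseIntervalᶜ = 0)
    {α β : ℝ} {N : ℕ} (hN : 0 < N) {Q c : ℝ} (hQ : 0 < Q) (hc : 0 < c)
    (hNQ : (N : ℝ) ≤ 2 * Q ^ (1 + β))
    (hA : c * Q ^ (-(1 - β)) ≤ μ.real (nearProgression N (4 * (N * Q ^ (-(2 + α))))))
    {p q : ℝ≥0∞} (hp0 : p ≠ 0) (hp : p ≠ ∞) (hq : 1 ≤ q) :
    ENNReal.ofReal (1 / 2 * c ^ (1 - 1 / q.toReal) * (1 / 576) ^ (1 / p.toReal) *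
        Q ^ ((1 + α - β) * (1 / p.toReal) - (1 - β) * (1 - 1 / q.toReal))) ≤
      eLpNorm (fourierDensity ((nearProgression N (4 * (N * Q ^ (-(2 + α))))).indicator
          fun _ => 1) μ) p volume /
        eLpNorm ((nearProgression N (4 * (N * Q ^ (-(2 + α))))).indicator
          fun _ => (1 : ℝ)) q μ := by
  set w := 4 * (N * Q ^ (-(2 + α))) with hw
  set A := nearProgression N w with hAdef
  have hAm : MeasurableSet A := (isClosed_nearProgression N w).measurableSet
  have hN' : (0 : ℝ) < N := by exact_mod_cast hN
  have hw0 : 0 < w := by positivity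
  set a := μ.real A with ha
  have ha0 : 0 < a := lt_of_lt_of_le (by positivity) hA
  have hμA : μ A = ENNReal.ofReal a := (ofReal_measureReal).symm
  have hμA0 : μ A ≠ 0 := by
    rw [hμA]
    simpa using ha0
  set κ := 1 / q.toReal with hκ
  set P := 1 / p.toReal with hP
  have hP0 : 0 ≤ P := by positivity
  have hκ1 : κ ≤ 1 := by
    rcases eq_or_ne q ∞ with rfl | hqt
    · simp [hκ]
    · have : 1 ≤ q.toReal := by simpa using ENNReal.toReal_mono hqt hq
      exact (div_le_one (by linarith)).2 this
  have hden : eLpNorm (A.indicator fun _ => (1 : ℝ)) q μ = ENNReal.ofReal (a ^ κ) := by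
    rw [eLpNorm_indicator_const' hAm hμA0 (by positivity), enorm_one, one_mul, hμA,
      ENNReal.ofReal_rpow_of_pos ha0]
  rw [hden]
  have hnum := ofReal_le_eLpNorm_fourierDensity hμ hN hw0 hp0 hp
  refine le_trans ?_ (ENNReal.div_le_div_right hnum _)
  rw [← ENNReal.ofReal_div_of_pos (by positivity)]
  refine ENNReal.ofReal_le_ofReal ?_
  -- `576 = 72 · 8`, where `8 = 4 · 2` comes from the width `4 N δ` and `N ≤ 2 Q^(1+β)`.
  have hV : 1 / 576 * Q ^ (1 + α - β) ≤ 1 / (72 * w) := by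
    have h1 : w ≤ 8 * Q ^ (-(1 + α - β)) := by
      calc w ≤ 4 * (2 * Q ^ (1 + β) * Q ^ (-(2 + α))) := by rw [hw]; gcongr
        _ = 8 * Q ^ (-(1 + α - β)) := by
          rw [mul_assoc 2, ← Real.rpow_add hQ]
          ring_nf
    calc 1 / 576 * Q ^ (1 + α - β) = 1 / (72 * (8 * Q ^ (-(1 + α - β)))) := by
          rw [Real.rpow_neg hQ.le]
          field_simp
          norm_num
      _ ≤ _ := by gcongr
  have hdiv : 1 / 2 * a * (1 / (72 * w)) ^ P / a ^ κ =
      1 / 2 * a ^ (1 - κ) * (1 / (72 * w)) ^ P := by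
    rw [Real.rpow_sub ha0, Real.rpow_one]
    ring
  change _ ≤ 1 / 2 * a * (1 / (72 * w)) ^ P / a ^ κ
  rw [hdiv]
  calc 1 / 2 * c ^ (1 - κ) * (1 / 576) ^ P * Q ^ ((1 + α - β) * P - (1 - β) * (1 - κ))
      = 1 / 2 * (c * Q ^ (-(1 - β))) ^ (1 - κ) * (1 / 576 * Q ^ (1 + α - β)) ^ P := by
        rw [Real.mul_rpow hc.le (by positivity), Real.mul_rpow (by norm_num) (by positivity),
          ← Real.rpow_mul hQ.le, ← Real.rpow_mul hQ.le, neg_mul,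
          sub_eq_neg_add ((1 + α - β) * P), Real.rpow_add hQ]
        ring
    _ ≤ _ := by gcongr

theorem theorem1p5 (α β : ℝ) (hα : 0 < α) (hβ0 : 0 ≤ β) (hβ1 : β < 1) :
    ∃ μ : Measure ℝ, IsProbabilityMeasure μ ∧
      -- the (closed) support
      μ.support ⊆ Icc (-1 / 2 : ℝ) (1 / 2) ∩ wellApproxSet α ∧
      -- regularity: all intervals, bounded or not, open, closed or half-open
      (∀ ε : ℝ, 0 < ε → ε < 2 / (2 + α) → ∃ C : ℝ, 0 < C ∧
        ∀ I : Set ℝ, I.OrdConnected →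
          μ I ≤ ENNReal.ofReal C * volume I ^ (2 / (2 + α) - ε)) ∧
      -- Fourier decay
      (∀ ε : ℝ, 0 < ε → ∃ C : ℝ, 0 < C ∧
        ∀ ξ : ℝ, ‖fourierMeasure μ ξ‖ ≤ C * (1 + |ξ|) ^ (-((1 - β) / (2 + α)) + ε)) ∧
      -- one sequence for all exponents; the quotients have finite, nonzero denominators
      ∃ f : ℕ → ℝ → ℝ, (∀ k x, 0 ≤ f k x) ∧
        ∀ q : ℝ≥0∞, 1 ≤ q →
          (∀ k, MemLp (f k) q μ ∧ eLpNorm (f k) q μ ≠ 0) ∧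
          ∀ p : ℝ≥0∞, 0 < p → p < pPlus α β q →
            ⨆ k, eLpNorm (fourierDensity (f k) μ) p volume / eLpNorm (f k) q μ = ∞ := by
  obtain ⟨ν, hν, hm1, hm2, hJ, hsupp, hdec, hreg, hprog⟩ := exists_limit_measure hα hβ0 hβ1
  set m := ν.real univ with hm
  have hm0 : 0 < m := by linarith
  have hminv : m⁻¹ ≤ 2 := by
    rw [inv_le_comm₀ hm0 two_pos]
    linarith
  -- Normalizing by a mass between `1/2` and `2` changes constants only; it turns the lower bound
  -- `1/8` into `1/16`.
  set μ : Measure ℝ := ENNReal.ofReal m⁻¹ • ν with hμ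
  have hμapp : ∀ s, μ s = ENNReal.ofReal m⁻¹ * ν s := fun s => rfl
  have hint : ∀ {E : Type} [NormedAddCommGroup E] [NormedSpace ℝ E] (f : ℝ → E),
      ∫ x, f x ∂μ = m⁻¹ • ∫ x, f x ∂ν := fun f => by
    rw [hμ, integral_smul_measure, ENNReal.toReal_ofReal (by positivity)]
  have hprob : IsProbabilityMeasure μ := ⟨by
    rw [hμapp, ← ofReal_measureReal, ← ENNReal.ofReal_mul (by positivity), ← hm,
      inv_mul_cancel₀ hm0.ne', ENNReal.ofReal_one]⟩
  have hJμ : μ baseIntervalᶜ = 0 := by rw [hμapp, hJ, mul_zero]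
  choose Q N hkQ hQ1 hN0 hNQ hA using hprog
  have hQ0 : ∀ k, 0 < Q k := fun k => by linarith [hQ1 k]
  set A : ℕ → Set ℝ := fun k => nearProgression (N k) (4 * (N k * Q k ^ (-(2 + α)))) with hAdef
  have hAm : ∀ k, MeasurableSet (A k) := fun k => (isClosed_nearProgression _ _).measurableSet
  have hAμ : ∀ k, 1 / 16 * Q k ^ (-(1 - β)) ≤ μ.real (A k) := fun k => by
    have h1 : μ.real (A k) = m⁻¹ * ν.real (A k) := by
      rw [measureReal_def, hμapp, ENNReal.toReal_mul, ENNReal.toReal_ofReal (by positivity)]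
      rfl
    have h2 : (1 / 2 : ℝ) ≤ m⁻¹ := by
      rw [one_div]
      exact inv_anti₀ hm0 hm2
    rw [h1]
    calc 1 / 16 * Q k ^ (-(1 - β)) = 1 / 2 * (1 / 8 * Q k ^ (-(1 - β))) := by ring
      _ ≤ m⁻¹ * ν.real (A k) := by
        have h3 : 0 ≤ 1 / 8 * Q k ^ (-(1 - β)) := by have := hQ0 k; positivity
        exact mul_le_mul h2 (hA k) h3 (by positivity)
  refine ⟨μ, hprob, fun x hx => ?_, fun ε hε hεd => ?_, fun ε hε => ?_,
    fun k => (A k).indicator fun _ => 1, fun k x => indicator_nonneg (fun _ _ => zero_le_one) x,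
    fun q hq => ⟨fun k => ⟨?_, ?_⟩, fun p hp0 hp => ?_⟩⟩
  · have hx1 : x ∈ baseInterval :=
      Measure.support_subset_of_isClosed isClosed_Icc (mem_ae_iff.2 hJμ) hx
    refine ⟨⟨by linarith [hx1.1], by linarith [hx1.2]⟩,
      mem_wellApproxSet_of_forall_approxBy fun k => ?_⟩
    -- Each `K` is closed and of full measure, so it contains the whole closed support, not merely
    -- almost all of it.
    obtain ⟨K, hK, hKα, hνK⟩ := hsupp k
    refine hKα (Measure.support_subset_of_isClosed hK (mem_ae_iff.2 ?_) hx)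
    rw [hμapp, hνK, mul_zero]
  · obtain ⟨C, hC, hCr⟩ := hreg ε hε
    refine ⟨m⁻¹ * C + 8 ^ (2 / (2 + α) - ε), by positivity, fun I hI =>
      measure_le_of_bumpMean_le hJμ (by positivity) (by linarith) (fun x hx r hr hr8 => ?_) hI⟩
    rw [bumpMean, hint, smul_eq_mul, mul_assoc]
    gcongr
    exact hCr x hx r hr hr8
  · obtain ⟨C, hC, hCξ⟩ := hdec ε hε
    refine ⟨m⁻¹ * C, by positivity, fun ξ => ?_⟩
    rw [fourierMeasure, hint, norm_smul, Real.norm_of_nonneg (by positivity)]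
    exact (mul_le_mul_of_nonneg_left (hCξ ξ) (inv_nonneg.2 hm0.le)).trans_eq (mul_assoc _ _ _).symm
  · exact memLp_indicator_const q (hAm k) 1 (Or.inr (measure_ne_top _ _))
  · have hpos : μ (A k) ≠ 0 := fun h0 => by
      have h1 := hAμ k
      rw [measureReal_def, h0, ENNReal.toReal_zero] at h1
      have := Real.rpow_pos_of_pos (hQ0 k) (-(1 - β))
      linarith
    rw [eLpNorm_indicator_const' (hAm k) hpos (by positivity), enorm_one, one_mul]
    exact (ENNReal.rpow_pos (pos_iff_ne_zero.2 hpos) (measure_ne_top _ _)).ne'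
  · have hexp := exponent_lt_of_lt_pPlus hα hβ1 hq hp
    have hpt : p ≠ ∞ := hp.ne_top
    have hpr : 0 < p.toReal := ENNReal.toReal_pos hp0.ne' hpt
    refine iSup_eq_top_of_rpow_le (Q := Q)
      (c := 1 / 2 * (1 / 16) ^ (1 - 1 / q.toReal) * (1 / 576) ^ (1 / p.toReal))
      (e := (1 + α - β) * (1 / p.toReal) - (1 - β) * (1 - 1 / q.toReal)) (by positivity) ?_ hkQ
      fun k => ofReal_le_quotient hJμ (hN0 k) (hQ0 k) (by norm_num) (hNQ k) (hAμ k) hp0.ne' hpt hq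
    rw [mul_one_div, sub_pos, lt_div_iff₀ hpr]
    linarith
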